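/- Let $G_1,G_2$ be locally compact (Hausdorff) abelian groups with Haar measures $du,dv$, and let $1<p,q<\infty$. For $A\subset G_1$, $B\subset G_2$ put $$\|f\|_{L^{p,q}(A\times B)}=\Big(\int_A\Big(\int_B|f(u,v)|^q\,dv\Big)^{p/q}du\Big)^{1/p},\qquad \|c\|_{\ell^{p,q}}=\Big(\sum_s\Big(\sum_t|c(s,t)|^q\Big)^{p/q}\Big)^{1/p},$$ and $\|\mathbf c\|_{\ell^{p,q}}=\sum_{i=1}^r\|c_i\|_{\ell^{p,q}}$ for $\mathbf c=(c_1,\dots,c_r)^T\in(\ell^{p,q})^r$. Let $I$ be a countable index set and let $\{x_s\}_{s\in I}\subset G_1$, $\{y_t\}_{t\in I}\subset G_2$ be separated, i.e. there are neighbourhoods $U_1,U_2$ of the identities such that the sets $x_s+U_1$ are pairwise disjoint and the sets $y_t+U_2$ are pairwise disjoint. Assume the following. (A1) $\omega\in L^1(G_1\times G_2)$ is supported in $W=W_1\times W_2$, where $W_1\subset G_1$, $W_2\subset G_2$ are compact and contain the identity elements, and $\|\omega\|_{L^1(W)}\neq0$. (A2) $K=K_1\times K_2$ with $K_1\subset G_1$,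 $K_2\subset G_2$ compact, $\widetilde K=K-W$, and $\Phi=(\phi_1,\dots,\phi_r)^T$, where $\phi_i\in L^{p,q}(G_1\times G_2)$ are continuous with compact support; there are $0<a_1\le a_2<\infty$ with $$a_1\|\mathbf c\|_{\ell^{p,q}}\le\Big\|\sum_{s,t}\mathbf c(s,t)^T\Phi(\cdot-x_s,\cdot-y_t)\Big\|_{L^{p,q}(\widetilde K)}\le a_2\|\mathbf c\|_{\ell^{p,q}}$$ for all $\mathbf c\in(\ell^{p,q})^r$ such that $\mathbf c(s,t)=0$ whenever $\Phi(\cdot-x_s,\cdot-y_t)\equiv0$ on $\widetilde K$. (A3) $\widetilde K-\Omega$ is sequentially compact, where $\Omega=\bigcup_{i=1}^r\operatorname{supp}\phi_i$. (A4) $\rho$ is a probability density on $K$ with $0<\mathcal C_{\rho,1}\le\rho(u,v)\le\mathcal C_{\rho,2}$ for all $(u,v)\in K$. Let $(u_{j,k},v_{j,k})$, $j,k\in\mathbb N$, be i.i.d. random points of $K$ (independent over all pairs $(j,k)$), each with density $\rho$. Let $$V_K(\Phi)=\Big\{f\in L^{p,q}(G_1\times G_2):\ f=\sum_{s,t}\mathbf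 c(s,t)^T\Phi(\cdot-x_s,\cdot-y_t)\text{ on }\widetilde K\text{ for some }\mathbf c\in(\ell^{p,q})^r\Big\},$$ let $d$ be the dimension over $\mathbb R$ of $V_K(\Phi)$, its elements being regarded as functions on $\widetilde K$, and assume $d\ge1$. Put $$\widetilde C_\Phi=\sup_{(u,v)\in\widetilde K}\sum_{i=1}^r\sum_{s,t}|\phi_i(u-x_s,v-y_t)|,\qquad \mathcal A_1=2\exp\Big(d\ln\frac{8\widetilde C_\Phi}{a_1}\Big),\qquad \mathcal A_2=\frac{4}{3d(\ln2)^2}\Big(\frac{4\widetilde C_\Phi}{a_1}\Big)^{2d}.$$ **Theorem.** Suppose that there is a constant $0<\widetilde\mu\le1$ such that $\widetilde\mu\,\|\omega\|_{L^1(W)}\|f\|_{L^{p,q}(\widetilde K)}\le\|f*\omega\|_{L^1(K)}$ for all $f\in V_K(\Phi)$. Let $0<\eta<\widetilde\mu\,\mathcal C_{\rho,1}$ and let $n,m\in\mathbb N$ satisfy $$nm>\frac{108\sqrt2\,(\ln2)\,d}{\eta}\Big(2+\frac{162}{\eta}\Big).$$ Then, with probability at least $$1-\mathcal A_1\exp\Big(-nm\frac{3a_1^2\eta^2}{4\widetilde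 C_\Phi(6\widetilde C_\Phi+\eta a_1)}\Big)-\mathcal A_2\exp\Big(-nm\frac{\eta^2}{72\sqrt2\,(81+\eta)}\Big),$$ there exist functions $h_{j,k}$, $1\le j\le n$, $1\le k\le m$ (depending on the sample points but not on $f$), such that every $f\in V_K(\Phi)$ satisfies $$f(u,v)=\sum_{j=1}^n\sum_{k=1}^m(f*\omega)(u_{j,k},v_{j,k})\,h_{j,k}(u,v),\qquad(u,v)\in\widetilde K.$$ -/

import Mathlib

open MeasureTheory ProbabilityTheory Set Filter Topology
open scoped ENNReal Pointwise

noncomputable section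

namespace RandomAverageSampling

/-- A family `x` in an additive topological group is separated: for some neighbourhood `U` of the
identity, the translates `x i + U` are pairwise disjoint. -/
def Separated {G ι : Type*} [AddCommGroup G] [TopologicalSpace G] (x : ι → G) : Prop :=
  ∃ U ∈ 𝓝 (0 : G), ∀ i j : ι, i ≠ j → (({x i} : Set G) + U) ∩ (({x j} : Set G) + U) = ∅

/-- The norm of `ℓ^{p,q}`, with value `∞` outside that space. -/
def seqNorm {ι : Type*} (p q : ℝ) (c : ι → ι → ℂ) : ℝ≥0∞ :=
  (∑' s : ι, (∑' t : ι, ‖c s t‖ₑ ^ q) ^ (p / q)) ^ (1 / p)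

section Analysis

variable {G₁ G₂ : Type*} [MeasurableSpace G₁] [MeasurableSpace G₂]

/-- The norm of `L^{p,q}(A × B)`, with value `∞` outside that space.
For `p = q = 1` it is the `L¹` norm over `A × B`. -/
def mixedNorm (μ₁ : Measure G₁) (μ₂ : Measure G₂) (p q : ℝ) (A : Set G₁) (B : Set G₂)
    (f : G₁ × G₂ → ℂ) : ℝ≥0∞ :=
  (∫⁻ u in A, (∫⁻ v in B, ‖f (u, v)‖ₑ ^ q ∂μ₂) ^ (p / q) ∂μ₁) ^ (1 / p)

/-- Membership in `L^{p,q}(G₁ × G₂)`; for `p = q = 1` this is `L¹(G₁ × G₂)`. -/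
def MemMixed (μ₁ : Measure G₁) (μ₂ : Measure G₂) (p q : ℝ) (f : G₁ × G₂ → ℂ) : Prop :=
  Measurable f ∧ mixedNorm μ₁ μ₂ p q univ univ f < ∞

/-- The Haar measure of `G₁ × G₂` restricted to the rectangle `A × B`. (Restricting first makes
this meaningful for compact `A`, `B` in groups whose Haar measures are not `σ`-finite.) -/
def rectMeasure (μ₁ : Measure G₁) (μ₂ : Measure G₂) (A : Set G₁) (B : Set G₂) :
    Measure (G₁ × G₂) :=
  (μ₁.restrict A).prod (μ₂.restrict B)

variable [AddCommGroup G₁] [AddCommGroup G₂]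

/-- The convolution `(f * g)(z) = ∫ f(z - w) g(w) dw` on `G₁ × G₂`. -/
def conv (μ₁ : Measure G₁) (μ₂ : Measure G₂) (f g : G₁ × G₂ → ℂ) (z : G₁ × G₂) : ℂ :=
  ∫ u, ∫ v, f (z.1 - u, z.2 - v) * g (u, v) ∂μ₂ ∂μ₁

variable {ι : Type*} {r : ℕ}

/-- The function `∑_{s,t} c(s,t)ᵀ Φ(· - x_s, · - y_t)`. -/
def shiftSum (φ : Fin r → G₁ × G₂ → ℂ) (x : ι → G₁) (y : ι → G₂) (c : Fin r → ι → ι → ℂ)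
    (z : G₁ × G₂) : ℂ :=
  ∑' st : ι × ι, ∑ i : Fin r, c i st.1 st.2 * φ i (z.1 - x st.1, z.2 - y st.2)

/-- Stability of the shifts of `Φ` on the rectangle `A × B` with bounds `a₁`, `a₂`. -/
def StableShifts (μ₁ : Measure G₁) (μ₂ : Measure G₂) (p q : ℝ) (A : Set G₁) (B : Set G₂)
    (φ : Fin r → G₁ × G₂ → ℂ) (x : ι → G₁) (y : ι → G₂) (a₁ a₂ : ℝ) : Prop :=
  ∀ c : Fin r → ι → ι → ℂ, (∀ i, seqNorm p q (c i) < ∞) →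
    (∀ s t, (∀ z ∈ A ×ˢ B, ∀ i, φ i (z.1 - x s, z.2 - y t) = 0) → ∀ i, c i s t = 0) →
    ENNReal.ofReal a₁ * ∑ i, seqNorm p q (c i) ≤ mixedNorm μ₁ μ₂ p q A B (shiftSum φ x y c) ∧
      mixedNorm μ₁ μ₂ p q A B (shiftSum φ x y c) ≤ ENNReal.ofReal a₂ * ∑ i, seqNorm p q (c i)

/-- The local quasi shift-invariant space: functions in `L^{p,q}(G₁ × G₂)` that coincide on
`A × B` with `∑_{s,t} c(s,t)ᵀ Φ(· - x_s, · - y_t)` for some `c ∈ (ℓ^{p,q})^r`. -/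
def localSpace (μ₁ : Measure G₁) (μ₂ : Measure G₂) (p q : ℝ) (A : Set G₁) (B : Set G₂)
    (φ : Fin r → G₁ × G₂ → ℂ) (x : ι → G₁) (y : ι → G₂) : Set (G₁ × G₂ → ℂ) :=
  {f | MemMixed μ₁ μ₂ p q f ∧ ∃ c : Fin r → ι → ι → ℂ, (∀ i, seqNorm p q (c i) < ∞) ∧
    ∀ z ∈ A ×ˢ B, f z = shiftSum φ x y c z}

/-- The real dimension of the local space, whose elements are regarded as functions on `A × B`. -/
def realDim (μ₁ : Measure G₁) (μ₂ : Measure G₂) (p q : ℝ) (A : Set G₁) (B : Set G₂)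
    (φ : Fin r → G₁ × G₂ → ℂ) (x : ι → G₁) (y : ι → G₂) : ℕ :=
  Module.finrank ℝ (Submodule.span ℝ
    ((fun (f : G₁ × G₂ → ℂ) (z : ↥(A ×ˢ B)) => f z) '' localSpace μ₁ μ₂ p q A B φ x y))

/-- `sup_{z ∈ A × B} ∑_i ∑_{s,t} |φ_i(z - (x_s, y_t))|`. -/
def supShift (A : Set G₁) (B : Set G₂) (φ : Fin r → G₁ × G₂ → ℂ) (x : ι → G₁) (y : ι → G₂) : ℝ :=
  ⨆ z : ↥(A ×ˢ B), ∑ i : Fin r, ∑' st : ι × ι, ‖φ i (z.1.1 - x st.1, z.1.2 - y st.2)‖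

end Analysis

end RandomAverageSampling

end

/-!
The proof counts dimensions instead of estimating suprema over a covering of the unit ball.

On the compact set `K - W` only finitely many shifts of the generators do not vanish, because the
shifts are separated (`finite_relevantShifts`). Hence the local space, regarded as a set of
functions on `K - W`, is a complex vector space of dimension `D = d / 2`, spanned by continuous
functions of compact support (`restrict_image_localSpace`, `realDim_eq`). A reconstruction formula
exists as soon as the linear map sending an element `f` of this space to the samples of `f * ω` is
injective: the functions `h` are read off from a left inverse
(`exists_dual_of_notMem_undetermined`).

Put `M = C_Φ / a₁`. Stability gives `|f| ≤ M ‖f‖` on `K - W` (`StableShifts.enorm_le`), hence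
`|f * ω| ≤ M ‖f‖ ‖ω‖` on `K`. On the other hand the hypotheses on `ω` and on the density bound the
expectation of `|f * ω|` at a sample point from below by `η ‖f‖ ‖ω‖`. So a single sample of `f * ω`
is nonzero with probability at least `t = η / M`, for every nonzero `f`
(`le_mul_measure_conv_ne_zero`).

Consequently, as long as the samples taken so far have a nonzero common kernel, the next sample
lowers the dimension of that kernel with probability at least `t`. Weighting a kernel of dimension
`k` by `b ^ k` shows that after `N` samples the kernel is nonzero with probability at most
`b ^ D * (1 - t + t / b) ^ N` (`measure_undetermined_le`). With `b = max 2 (8 M)` this is at most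
the first exponential term of the claimed bound (`max_pow_mul_pow_le`); the second one is
nonnegative.
-/

noncomputable section

namespace RandomAverageSampling

/-! ### Random functionals on a finite-dimensional space -/

section Undetermined

variable {D : ℕ}

/-- The families of `N` linear functionals on `ℂ^D` (functionals being written as vectors `x`
acting by `a ↦ x ⬝ᵥ a`) that vanish simultaneously at some nonzero vector of the subspace `U`. -/
def undetermined (U : Submodule ℂ (Fin D → ℂ)) (N : ℕ) : Set (Fin N → Fin D → ℂ) :=
  {x | ∃ a ∈ U, a ≠ 0 ∧ ∀ k, x k ⬝ᵥ a = 0}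

/-- By homogeneity the common zero can be taken in the unit sphere of `U`, which is compact. -/
lemma isClosed_undetermined (U : Submodule ℂ (Fin D → ℂ)) (N : ℕ) :
    IsClosed (undetermined U N) := by
  set C : Set (Fin D → ℂ) := (U : Set (Fin D → ℂ)) ∩ Metric.sphere 0 1
  have hCc : IsCompact C := (isCompact_sphere _ _).inter_left U.closed_of_finiteDimensional
  have : CompactSpace C := isCompact_iff_compactSpace.1 hCc
  have hcl : IsClosed {q : C × (Fin N → Fin D → ℂ) | ∀ k, q.2 k ⬝ᵥ (q.1 : Fin D → ℂ) = 0} := by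
    simp only [ofPred_forall, dotProduct]
    refine isClosed_iInter fun k => isClosed_eq ?_ continuous_const
    refine continuous_finsetSum _ fun i _ => Continuous.mul ?_ ?_
    · exact (continuous_apply i).comp ((continuous_apply k).comp continuous_snd)
    · exact (continuous_apply i).comp (continuous_subtype_val.comp continuous_fst)
  convert isClosedMap_snd_of_compactSpace _ hcl using 1
  ext x
  constructor
  · rintro ⟨a, haU, ha0, hax⟩
    have hn : ‖a‖ ≠ 0 := norm_ne_zero_iff.2 ha0
    refine ⟨(⟨((‖a‖⁻¹ : ℝ) : ℂ) • a, U.smul_mem _ haU, ?_⟩, x), fun k => ?_, rfl⟩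
    · simp [norm_smul, hn]
    · simp [hax k]
  · rintro ⟨⟨⟨a, haU, ha1⟩, x'⟩, h, rfl⟩
    refine ⟨a, haU, ?_, h⟩
    rintro rfl
    simp at ha1

/-- The subspace of `U` annihilated by the functional `x`. -/
def annihilated (U : Submodule ℂ (Fin D → ℂ)) (x : Fin D → ℂ) : Submodule ℂ (Fin D → ℂ) where
  carrier := {a | a ∈ U ∧ x ⬝ᵥ a = 0}
  zero_mem' := ⟨U.zero_mem, by simp⟩
  add_mem' := fun ha hb => ⟨U.add_mem ha.1 hb.1, by simp [ha.2, hb.2]⟩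
  smul_mem' := fun c _ ha => ⟨U.smul_mem c ha.1, by simp [ha.2]⟩

lemma annihilated_le (U : Submodule ℂ (Fin D → ℂ)) (x : Fin D → ℂ) : annihilated U x ≤ U :=
  fun _ h => h.1

lemma finrank_annihilated_lt {U : Submodule ℂ (Fin D → ℂ)} {x a : Fin D → ℂ} (ha : a ∈ U)
    (hx : x ⬝ᵥ a ≠ 0) :
    Module.finrank ℂ (annihilated U x) < Module.finrank ℂ U :=
  Submodule.finrank_lt_finrank_of_lt
    (lt_of_le_of_ne (annihilated_le U x) fun h => hx (h.symm ▸ ha : a ∈ annihilated U x).2)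

/-- If every nonzero vector is annihilated by a random functional with probability at most
`1 - t`, then `N` independent copies fail to separate the points of `U` with probability at most
`b ^ dim U * (1 - t + t / b) ^ N`, for every `b ≥ 1`. Conditionally on the first functional, it
remains to separate the points of its kernel in `U`, whose dimension has dropped with probability
at least `t`; hence the induction on `N` over all subspaces. -/
lemma measure_undetermined_le (ν : Measure (Fin D → ℂ)) [IsProbabilityMeasure ν]
    {t b : ℝ} (ht : t ≤ 1) (hb : 1 ≤ b) (ht0 : 0 ≤ t)
    (hν : ∀ a : Fin D → ℂ, a ≠ 0 → ν.real {x | x ⬝ᵥ a = 0} ≤ 1 - t) (N : ℕ) :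
    ∀ U : Submodule ℂ (Fin D → ℂ),
      (Measure.pi fun _ : Fin N => ν) (undetermined U N) ≤
        ENNReal.ofReal (b ^ Module.finrank ℂ U * (1 - t + t / b) ^ N) := by
  have hb0 : 0 < b := by linarith
  have hq : 0 ≤ 1 - t + t / b := by
    have : 0 ≤ t / b := by positivity
    linarith
  induction N with
  | zero =>
    intro U
    refine prob_le_one.trans ?_
    rw [ENNReal.one_le_ofReal, pow_zero, mul_one]
    exact one_le_pow₀ hb
  | succ N ih =>
    intro U
    by_cases hU : U = ⊥
    · have : undetermined U (N + 1) = ∅ := by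
        ext x
        simp only [undetermined, mem_ofPred_eq, mem_empty_iff_false, iff_false]
        rintro ⟨a, ha, ha0, -⟩
        rw [hU] at ha
        exact ha0 (by simpa using ha)
      simp [this]
    obtain ⟨a, haU, ha0⟩ := U.ne_bot_iff.1 hU
    set k := Module.finrank ℂ U with hk
    set A : Set (Fin D → ℂ) := {x | x ⬝ᵥ a = 0} with hA
    have hAm : MeasurableSet A := by
      refine IsClosed.measurableSet (isClosed_eq ?_ continuous_const)
      simp only [dotProduct]
      fun_prop
    set q := 1 - t + t / b with hqdef
    have hk1 : 1 ≤ k := by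
      rw [hk]
      exact Submodule.one_le_finrank_iff.2 hU
    have hmp := measurePreserving_piFinSuccAbove (fun _ : Fin (N + 1) => ν) 0
    have hclosed := (isClosed_undetermined U (N + 1)).measurableSet
    have hpre : undetermined U (N + 1) = MeasurableEquiv.piFinSuccAbove (fun _ => Fin D → ℂ) 0 ⁻¹'
        ((MeasurableEquiv.piFinSuccAbove (fun _ => Fin D → ℂ) 0).symm ⁻¹'
          undetermined U (N + 1)) := by
      ext x
      simp
    have hms := (MeasurableEquiv.piFinSuccAbove (fun _ : Fin (N + 1) => Fin D → ℂ) 0).symm.measurable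
      hclosed
    rw [hpre, hmp.measure_preimage hms.nullMeasurableSet, Measure.prod_apply hms]
    have hslice : ∀ x : Fin D → ℂ, Prod.mk x ⁻¹'
        ((MeasurableEquiv.piFinSuccAbove (fun _ => Fin D → ℂ) 0).symm ⁻¹' undetermined U (N + 1))
          = undetermined (annihilated U x) N := by
      intro x
      ext y
      simp only [undetermined, mem_preimage, mem_ofPred_eq, Fin.forall_fin_succ]
      constructor
      · rintro ⟨c, hc, hc0, h1, h2⟩
        exact ⟨c, ⟨hc, by simpa using h1⟩, hc0, fun i => by simpa using h2 i⟩
      · rintro ⟨c, ⟨hc, h1⟩, hc0, h2⟩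
        exact ⟨c, hc, hc0, by simpa using h1, fun i => by simpa using h2 i⟩
    simp only [hslice]
    calc ∫⁻ x, (Measure.pi fun _ : Fin N => ν) (undetermined (annihilated U x) N) ∂ν
        ≤ ∫⁻ x, A.indicator (fun _ => ENNReal.ofReal (b ^ k * q ^ N)) x +
            Aᶜ.indicator (fun _ => ENNReal.ofReal (b ^ (k - 1) * q ^ N)) x ∂ν := by
          refine lintegral_mono fun x => (ih (annihilated U x)).trans ?_
          by_cases hx : x ∈ A
          · simp only [indicator_of_mem hx, indicator_of_notMem (notMem_compl_iff.2 hx), add_zero]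
            refine ENNReal.ofReal_le_ofReal ?_
            gcongr
            exact Submodule.finrank_mono (annihilated_le U x)
          · simp only [indicator_of_notMem hx, indicator_of_mem (mem_compl hx), zero_add]
            refine ENNReal.ofReal_le_ofReal ?_
            have := finrank_annihilated_lt haU hx
            gcongr
            omega
      _ = ENNReal.ofReal (b ^ k * q ^ N) * ν A + ENNReal.ofReal (b ^ (k - 1) * q ^ N) * ν Aᶜ := by
          rw [lintegral_add_left (measurable_const.indicator hAm), lintegral_indicator_const hAm,
            lintegral_indicator_const hAm.compl]
      _ = ENNReal.ofReal (b ^ k * q ^ N * ν.real A + b ^ (k - 1) * q ^ N * (1 - ν.real A)) := by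
          rw [← probReal_compl_eq_one_sub hAm, ENNReal.ofReal_add (by positivity) (by positivity),
            ENNReal.ofReal_mul (p := b ^ k * q ^ N) (by positivity),
            ENNReal.ofReal_mul (p := b ^ (k - 1) * q ^ N) (by positivity),
            ofReal_measureReal, ofReal_measureReal]
      _ ≤ ENNReal.ofReal (b ^ k * q ^ (N + 1)) := by
          refine ENNReal.ofReal_le_ofReal ?_
          obtain ⟨l, hl⟩ : ∃ l, k = l + 1 := ⟨k - 1, by omega⟩
          have hqb : b * q = b - (b - 1) * t := by
            rw [hqdef]
            field_simp
            ring
          have h1 := hν a ha0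
          have h2 : b * ν.real A + (1 - ν.real A) ≤ b * q := by
            rw [hqb]
            nlinarith
          calc b ^ k * q ^ N * ν.real A + b ^ (k - 1) * q ^ N * (1 - ν.real A)
              = b ^ l * q ^ N * (b * ν.real A + (1 - ν.real A)) := by
                rw [hl, Nat.add_sub_cancel]; ring
            _ ≤ b ^ l * q ^ N * (b * q) := by gcongr
            _ = b ^ k * q ^ (N + 1) := by rw [hl]; ring

lemma iIndepFun_measure_undetermined_le {S : Type*} [MeasurableSpace S] {P : Measure S}
    [IsProbabilityMeasure P] {N : ℕ} {X : Fin N → S → Fin D → ℂ} (hX : ∀ k, Measurable (X k))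
    (hind : iIndepFun X P) {ν : Measure (Fin D → ℂ)} [IsProbabilityMeasure ν]
    (hlaw : ∀ k, P.map (X k) = ν) {t b : ℝ} (ht : t ≤ 1) (hb : 1 ≤ b) (ht0 : 0 ≤ t)
    (hν : ∀ a : Fin D → ℂ, a ≠ 0 → ν.real {x | x ⬝ᵥ a = 0} ≤ 1 - t) :
    P.real ((fun e k => X k e) ⁻¹' undetermined ⊤ N) ≤ b ^ D * (1 - t + t / b) ^ N := by
  have h := measure_undetermined_le ν ht hb ht0 hν N ⊤
  rw [finrank_top, Module.finrank_fin_fun] at h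
  refine ENNReal.toReal_le_of_le_ofReal ?_ ?_
  · have : 0 ≤ t / b := by positivity
    have : 0 ≤ 1 - t + t / b := by linarith
    positivity
  · rw [← Measure.map_apply (measurable_pi_lambda _ hX) (isClosed_undetermined _ _).measurableSet,
      (iIndepFun_iff_map_fun_eq_pi_map fun k => (hX k).aemeasurable).1 hind]
    simpa only [hlaw] using h

/-- Functionals without a common zero separate points, so the map of joint evaluation has a
linear left inverse; `ψ` consists of the images of the unit vectors under it. -/
lemma exists_dual_of_notMem_undetermined {N : ℕ} {X : Fin N → Fin D → ℂ}
    (hX : X ∉ undetermined ⊤ N) :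
    ∃ ψ : Fin N → Fin D → ℂ, ∀ a, a = ∑ l, (X l ⬝ᵥ a) • ψ l := by
  let L : (Fin D → ℂ) →ₗ[ℂ] (Fin N → ℂ) := Matrix.mulVecLin X
  have hL : ∀ a l, L a l = X l ⬝ᵥ a := fun a l => rfl
  have hker : LinearMap.ker L = ⊥ := by
    refine LinearMap.ker_eq_bot'.2 fun a ha => ?_
    by_contra ha0
    exact hX ⟨a, trivial, ha0, fun k => by simpa [hL] using congrFun ha k⟩
  obtain ⟨ℓ, hℓ⟩ := L.exists_leftInverse_of_injective hker
  refine ⟨fun l => ℓ (Pi.single l 1), fun a => ?_⟩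
  have h : L a = ∑ l, L a l • Pi.single l 1 := by
    ext k
    simp [Pi.single_apply]
  calc a = ℓ (L a) := (LinearMap.congr_fun hℓ a).symm
    _ = ∑ l, (X l ⬝ᵥ a) • ℓ (Pi.single l 1) := by
      conv_lhs => rw [h, map_sum]
      simp only [map_smul, hL]

end Undetermined

/-! ### Comparison of the failure probability with the stated bound -/

/-- The choice `b = max 2 (8 M)` bounds the failure probability by the first exponential term of
the sampling theorem. If `8 M ≥ 2`, the prefactors agree and only the exponents are compared. If
`8 M < 2`, the ratio of the prefactors is absorbed by the exponential, because the number `N` of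
samples is large compared with `d / η`. -/
lemma max_pow_mul_pow_le {M η : ℝ} {d N : ℕ} (hM : 0 < M) (hη : 0 < η) (hηM : η ≤ M)
    (hN : 108 * Real.sqrt 2 * Real.log 2 * (d : ℝ) / η * (2 + 162 / η) < N) :
    max 2 (8 * M) ^ d * (1 - η / M + η / M / max 2 (8 * M)) ^ N ≤
      2 * Real.exp (d * Real.log (8 * M)) *
        Real.exp (-(N * (3 * η ^ 2 / (4 * M * (6 * M + η))))) := by
  set b := max 2 (8 * M) with hbdef
  have hb2 : 2 ≤ b := le_max_left _ _
  have hb0 : 0 < b := by linarith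
  set t := η / M with ht
  have ht0 : 0 < t := by positivity
  have ht1 : t ≤ 1 := (div_le_one hM).2 hηM
  have hη' : η = t * M := by rw [ht]; field_simp
  have hq0 : 0 ≤ 1 - t + t / b := by
    have : 0 ≤ t / b := by positivity
    linarith
  have hq : 1 - t + t / b ≤ Real.exp (-(t / 2)) := by
    have h1 : t / b ≤ t / 2 := by gcongr
    have h2 := Real.add_one_le_exp (-(t / 2))
    linarith
  have hexp : 3 * η ^ 2 / (4 * M * (6 * M + η)) ≤ t / 8 := by
    rw [hη', div_le_div_iff₀ (by positivity) (by norm_num)]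
    have : t * t * M ^ 2 ≤ t * M ^ 2 := by nlinarith [mul_pos ht0 (sq_pos_of_pos hM)]
    nlinarith [mul_pos ht0 (sq_pos_of_pos hM), mul_pos ht0 (mul_pos ht0 (sq_pos_of_pos hM))]
  have hpow : b ^ d * (1 - t + t / b) ^ N ≤ Real.exp (d * Real.log b - N * (t / 2)) := by
    calc b ^ d * (1 - t + t / b) ^ N ≤ b ^ d * Real.exp (-(t / 2)) ^ N := by gcongr
      _ = Real.exp (d * Real.log b - N * (t / 2)) := by
        rw [sub_eq_add_neg, Real.exp_add, ← Real.exp_nat_mul, ← Real.rpow_natCast b,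
          Real.rpow_def_of_pos hb0, mul_comm (Real.log b)]
        congr 2
        ring
  have hN0 : (0 : ℝ) ≤ N := by positivity
  have hmain : d * Real.log b - N * (t / 2) ≤ d * Real.log (8 * M) - N * (t / 8) := by
    rcases le_total 2 (8 * M) with h | h
    · rw [hbdef, max_eq_right h]
      nlinarith
    · rw [hbdef, max_eq_left h]
      have hlog : Real.log 2 - Real.log (8 * M) ≤ 1 / (4 * M) := by
        rw [← Real.log_div (by norm_num) (by positivity)]
        have h3 := Real.log_le_sub_one_of_pos (show 0 < 2 / (8 * M) by positivity)
        have h4 : 2 / (8 * M) = 1 / (4 * M) := by field_simp; norm_num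
        linarith
      have hs : 1 ≤ Real.sqrt 2 := Real.one_le_sqrt.2 (by norm_num)
      have hl : 1 / 2 ≤ Real.log 2 := by linarith [Real.log_two_gt_d9]
      have hbig : (d : ℝ) / η ≤ N := by
        refine le_trans ?_ hN.le
        have h5 : (0 : ℝ) ≤ d / η := by positivity
        have h6 : (2 : ℝ) ≤ 2 + 162 / η := by
          have : 0 < 162 / η := by positivity
          linarith
        have h7 : 1 ≤ 108 * Real.sqrt 2 * Real.log 2 := by nlinarith
        calc (d : ℝ) / η ≤ 108 * Real.sqrt 2 * Real.log 2 * (d / η) * 1 := by nlinarith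
          _ ≤ 108 * Real.sqrt 2 * Real.log 2 * (d / η) * (2 + 162 / η) := by
              gcongr
              linarith
          _ = _ := by ring
      have hNt : (d : ℝ) / M ≤ N * t := by
        calc (d : ℝ) / M = d / η * t := by rw [ht]; field_simp
          _ ≤ N * t := by gcongr
      have : d * (Real.log 2 - Real.log (8 * M)) ≤ d * (1 / (4 * M)) := by gcongr
      have h8 : (d : ℝ) * (1 / (4 * M)) = (d / M) / 4 := by field_simp
      nlinarith
  calc b ^ d * (1 - t + t / b) ^ N ≤ Real.exp (d * Real.log b - N * (t / 2)) := hpow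
    _ ≤ Real.exp (d * Real.log (8 * M) + -(N * (3 * η ^ 2 / (4 * M * (6 * M + η))))) := by
      refine Real.exp_le_exp.2 (hmain.trans ?_)
      nlinarith
    _ = 1 * Real.exp (d * Real.log (8 * M)) *
          Real.exp (-(N * (3 * η ^ 2 / (4 * M * (6 * M + η))))) := by
      rw [Real.exp_add, one_mul]
    _ ≤ _ := by gcongr; norm_num

/-! ### Finitely many shifts matter on a compact rectangle -/

section Shifts

/-- Cover the compact set by translates of a neighbourhood `V` with `V - V ⊆ U`, where the
translates of `U` separate the family: each of the finitely many translates contains at most one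
member of the family. -/
lemma Separated.finite_mem {G ι : Type*} [AddCommGroup G] [TopologicalSpace G]
    [IsTopologicalAddGroup G] {x : ι → G} (hx : Separated x) {C : Set G} (hC : IsCompact C) :
    {s | x s ∈ C}.Finite := by
  obtain ⟨U, hU, hsep⟩ := hx
  obtain ⟨V, hV, hVU⟩ := exists_nhds_half_neg hU
  have hnhds : ∀ g ∈ C, {h : G | h - g ∈ V} ∈ 𝓝 g := fun g _ =>
    (continuous_id.sub continuous_const).continuousAt.preimage_mem_nhds (by simpa using hV)
  obtain ⟨T, hT⟩ := hC.elim_nhds_subcover' (fun g _ => {h : G | h - g ∈ V}) hnhds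
  refine (T.finite_toSet.biUnion fun g _ => ?_ :
    (⋃ g ∈ (T : Set C), {s | x s - (g : G) ∈ V}).Finite).subset ?_
  · refine Set.Subsingleton.finite fun i hi j hj => ?_
    by_contra hij
    have h0 : x i ∈ (({x i} : Set G) + U) ∩ (({x j} : Set G) + U) := by
      refine ⟨⟨x i, rfl, 0, mem_of_mem_nhds hU, by simp⟩, ⟨x j, rfl, x i - x j, ?_, by simp⟩⟩
      simpa using hVU _ hi _ hj
    rw [hsep i j hij] at h0
    exact h0
  · intro s hs
    have := hT hs
    simp only [mem_iUnion] at this ⊢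
    obtain ⟨g, hg, h⟩ := this
    exact ⟨g, hg, h⟩

lemma isCompact_sub {G : Type*} [AddCommGroup G] [TopologicalSpace G] [IsTopologicalAddGroup G]
    {A B : Set G} (hA : IsCompact A) (hB : IsCompact B) : IsCompact (A - B) := by
  rw [← Set.sub_image_prod]
  exact (hA.prod hB).image continuous_sub

variable {G₁ G₂ : Type*} [AddCommGroup G₁] [AddCommGroup G₂] {ι : Type*} {r : ℕ}

/-- The pairs `(s, t)` for which the shifts by `(x_s, y_t)` of the generators do not all vanish
on `A × B`. -/
def relevantShifts (A : Set G₁) (B : Set G₂) (φ : Fin r → G₁ × G₂ → ℂ) (x : ι → G₁)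
    (y : ι → G₂) : Set (ι × ι) :=
  {st | ∃ z ∈ A ×ˢ B, ∃ i, φ i (z.1 - x st.1, z.2 - y st.2) ≠ 0}

lemma finite_relevantShifts [TopologicalSpace G₁] [IsTopologicalAddGroup G₁]
    [TopologicalSpace G₂] [IsTopologicalAddGroup G₂] {A : Set G₁} {B : Set G₂}
    (hA : IsCompact A) (hB : IsCompact B) {φ : Fin r → G₁ × G₂ → ℂ}
    (hφ : ∀ i, HasCompactSupport (φ i)) {x : ι → G₁} {y : ι → G₂} (hx : Separated x)
    (hy : Separated y) : (relevantShifts A B φ x y).Finite := by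
  refine (Set.finite_iUnion fun i : Fin r =>
    (hx.finite_mem (isCompact_sub hA ((hφ i).isCompact.image continuous_fst))).prod
      (hy.finite_mem (isCompact_sub hB ((hφ i).isCompact.image continuous_snd)))).subset ?_
  rintro ⟨s, t⟩ ⟨z, ⟨hz1, hz2⟩, i, hi⟩
  have hmem := subset_tsupport (φ i) hi
  refine mem_iUnion.2 ⟨i, ?_, ?_⟩
  · exact ⟨z.1, hz1, z.1 - x s, ⟨_, hmem, rfl⟩, by simp⟩
  · exact ⟨z.2, hz2, z.2 - y t, ⟨_, hmem, rfl⟩, by simp⟩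

/-- The sum of the shifts over a finite set `T` of pairs, as a linear function of the
coefficients. In contrast to `shiftSum` it is a finite sum at every point of the group. -/
def shiftMap (φ : Fin r → G₁ × G₂ → ℂ) (x : ι → G₁) (y : ι → G₂) (T : Finset (ι × ι)) :
    (Fin r → ι → ι → ℂ) →ₗ[ℂ] (G₁ × G₂ → ℂ) where
  toFun c z := ∑ st ∈ T, ∑ i : Fin r, c i st.1 st.2 * φ i (z.1 - x st.1, z.2 - y st.2)
  map_add' c c' := by
    ext z
    simp [add_mul, Finset.sum_add_distrib]
  map_smul' a c := by
    ext z
    simp [Finset.mul_sum, mul_assoc]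

lemma shiftMap_apply (φ : Fin r → G₁ × G₂ → ℂ) (x : ι → G₁) (y : ι → G₂) (T : Finset (ι × ι))
    (c : Fin r → ι → ι → ℂ) (z : G₁ × G₂) : shiftMap φ x y T c z =
      ∑ st ∈ T, ∑ i : Fin r, c i st.1 st.2 * φ i (z.1 - x st.1, z.2 - y st.2) := rfl

lemma eq_zero_of_notMem_relevantShifts {A : Set G₁} {B : Set G₂} {φ : Fin r → G₁ × G₂ → ℂ}
    {x : ι → G₁} {y : ι → G₂} {st : ι × ι} (hst : st ∉ relevantShifts A B φ x y)
    {z : G₁ × G₂} (hz : z ∈ A ×ˢ B) (i : Fin r) : φ i (z.1 - x st.1, z.2 - y st.2) = 0 := by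
  by_contra h
  exact hst ⟨z, hz, i, h⟩

lemma shiftSum_eq_shiftMap {A : Set G₁} {B : Set G₂} {φ : Fin r → G₁ × G₂ → ℂ}
    {x : ι → G₁} {y : ι → G₂} {T : Finset (ι × ι)} (hT : relevantShifts A B φ x y ⊆ T)
    (c : Fin r → ι → ι → ℂ) {z : G₁ × G₂} (hz : z ∈ A ×ˢ B) :
    shiftSum φ x y c z = shiftMap φ x y T c z := by
  rw [shiftSum, shiftMap_apply]
  refine tsum_eq_sum fun st hst => Finset.sum_eq_zero fun i _ => ?_
  rw [eq_zero_of_notMem_relevantShifts (fun h => hst (hT h)) hz i, mul_zero]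

open Classical in
/-- The coefficients `c`, set to zero outside the finite set `T`. -/
def truncate (T : Finset (ι × ι)) (c : Fin r → ι → ι → ℂ) : Fin r → ι → ι → ℂ :=
  fun i s t => if (s, t) ∈ T then c i s t else 0

lemma truncate_of_notMem {T : Finset (ι × ι)} (c : Fin r → ι → ι → ℂ) (i : Fin r) {s t : ι}
    (h : (s, t) ∉ T) : truncate T c i s t = 0 := if_neg h

lemma shiftMap_truncate (φ : Fin r → G₁ × G₂ → ℂ) (x : ι → G₁) (y : ι → G₂) (T : Finset (ι × ι))
    (c : Fin r → ι → ι → ℂ) : shiftMap φ x y T (truncate T c) = shiftMap φ x y T c := by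
  ext z
  simp only [shiftMap_apply]
  exact Finset.sum_congr rfl fun st hst => Finset.sum_congr rfl fun i _ => by
    rw [truncate, if_pos hst]

lemma continuous_shiftMap [TopologicalSpace G₁] [IsTopologicalAddGroup G₁]
    [TopologicalSpace G₂] [IsTopologicalAddGroup G₂] {φ : Fin r → G₁ × G₂ → ℂ}
    (hφ : ∀ i, Continuous (φ i)) (x : ι → G₁) (y : ι → G₂) (T : Finset (ι × ι))
    (c : Fin r → ι → ι → ℂ) : Continuous (shiftMap φ x y T c) := by
  simp only [funext (shiftMap_apply φ x y T c)]
  fun_prop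

lemma hasCompactSupport_shiftMap [TopologicalSpace G₁] [IsTopologicalAddGroup G₁] [T2Space G₁]
    [TopologicalSpace G₂] [IsTopologicalAddGroup G₂] [T2Space G₂] {φ : Fin r → G₁ × G₂ → ℂ}
    (hφ : ∀ i, HasCompactSupport (φ i)) (x : ι → G₁) (y : ι → G₂) (T : Finset (ι × ι))
    (c : Fin r → ι → ι → ℂ) : HasCompactSupport (shiftMap φ x y T c) := by
  have hc : ∀ (st : ι × ι) (i : Fin r),
      IsCompact ((fun w : G₁ × G₂ => (w.1 + x st.1, w.2 + y st.2)) '' tsupport (φ i)) :=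
    fun st i => (hφ i).isCompact.image (by fun_prop)
  refine HasCompactSupport.intro (T.isCompact_biUnion fun st _ =>
    isCompact_iUnion fun i : Fin r => hc st i) fun z hz => ?_
  rw [shiftMap_apply]
  refine Finset.sum_eq_zero fun st hst => Finset.sum_eq_zero fun i _ => ?_
  rw [image_eq_zero_of_notMem_tsupport (f := φ i), mul_zero]
  intro hmem
  refine hz (mem_biUnion hst (mem_iUnion.2 ⟨i, _, hmem, ?_⟩))
  simp

/-- The supremum in `supShift` is a genuine one: the sums involve only finitely many bounded
functions. -/
lemma sum_norm_shift_le_supShift [TopologicalSpace G₁] [TopologicalSpace G₂] {A : Set G₁}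
    {B : Set G₂} {φ : Fin r → G₁ × G₂ → ℂ} {x : ι → G₁} {y : ι → G₂} {T : Finset (ι × ι)}
    (hφ : ∀ i, Continuous (φ i))
    (hφc : ∀ i, HasCompactSupport (φ i)) (hT : relevantShifts A B φ x y ⊆ T) {z : G₁ × G₂}
    (hz : z ∈ A ×ˢ B) :
    ∑ st ∈ T, ∑ i, ‖φ i (z.1 - x st.1, z.2 - y st.2)‖ ≤ supShift A B φ x y := by
  have hfin : ∀ z : ↥(A ×ˢ B),
      ∑ i : Fin r, ∑' st : ι × ι, ‖φ i (z.1.1 - x st.1, z.1.2 - y st.2)‖ =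
        ∑ st ∈ T, ∑ i, ‖φ i (z.1.1 - x st.1, z.1.2 - y st.2)‖ := by
    intro z
    rw [Finset.sum_comm]
    refine Finset.sum_congr rfl fun i _ => tsum_eq_sum fun st hst => ?_
    rw [eq_zero_of_notMem_relevantShifts (fun h => hst (hT h)) z.2 i, norm_zero]
  choose C hC using fun i => (hφ i).bounded_above_of_compact_support (hφc i)
  have hbdd : BddAbove (range fun z : ↥(A ×ˢ B) =>
      ∑ i : Fin r, ∑' st : ι × ι, ‖φ i (z.1.1 - x st.1, z.1.2 - y st.2)‖) := by
    refine ⟨∑ st ∈ T, ∑ i, C i, ?_⟩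
    rintro _ ⟨z, rfl⟩
    dsimp only
    rw [hfin]
    exact Finset.sum_le_sum fun st _ => Finset.sum_le_sum fun i _ => hC i _
  have := le_ciSup hbdd ⟨z, hz⟩
  rw [hfin] at this
  exact this

end Shifts

/-! ### Norms of coefficient families -/

section Coefficients

variable {ι : Type*} {p q : ℝ}

lemma enorm_le_seqNorm (hp : 0 < p) (hq : 0 < q) (c : ι → ι → ℂ) (s t : ι) :
    ‖c s t‖ₑ ≤ seqNorm p q c := by
  have h1 : ‖c s t‖ₑ ^ q ≤ ∑' t, ‖c s t‖ₑ ^ q := ENNReal.le_tsum t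
  have h2 : (‖c s t‖ₑ ^ q) ^ (p / q) ≤ ∑' s, (∑' t, ‖c s t‖ₑ ^ q) ^ (p / q) :=
    (ENNReal.rpow_le_rpow h1 (by positivity)).trans
      (ENNReal.le_tsum (f := fun s => (∑' t, ‖c s t‖ₑ ^ q) ^ (p / q)) s)
  have h3 := ENNReal.rpow_le_rpow h2 (show 0 ≤ 1 / p by positivity)
  refine le_trans (le_of_eq ?_) h3
  rw [← ENNReal.rpow_mul, ← ENNReal.rpow_mul, show q * (p / q * (1 / p)) = 1 by field_simp,
    ENNReal.rpow_one]

lemma seqNorm_lt_top (hp : 0 < p) (hq : 0 < q) {c : ι → ι → ℂ} (T : Finset (ι × ι))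
    (hc : ∀ s t, (s, t) ∉ T → c s t = 0) : seqNorm p q c < ∞ := by
  classical
  have h1 : ∀ s, ∑' t, ‖c s t‖ₑ ^ q = ∑ t ∈ T.image Prod.snd, ‖c s t‖ₑ ^ q := fun s =>
    tsum_eq_sum fun t ht => by
      rw [hc s t fun h => ht (Finset.mem_image_of_mem Prod.snd h), enorm_zero,
        ENNReal.zero_rpow_of_pos hq]
  have h2 : ∑' s, (∑' t, ‖c s t‖ₑ ^ q) ^ (p / q) =
      ∑ s ∈ T.image Prod.fst, (∑' t, ‖c s t‖ₑ ^ q) ^ (p / q) :=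
    tsum_eq_sum fun s hs => by
      have : ∑' t, ‖c s t‖ₑ ^ q = 0 := ENNReal.tsum_eq_zero.2 fun t => by
        rw [hc s t fun h => hs (Finset.mem_image_of_mem Prod.fst h), enorm_zero,
          ENNReal.zero_rpow_of_pos hq]
      rw [this, ENNReal.zero_rpow_of_pos (by positivity)]
  rw [seqNorm, h2]
  refine ENNReal.rpow_lt_top_of_nonneg (by positivity) (ENNReal.sum_lt_top.2 fun s _ => ?_).ne
  rw [h1]
  refine ENNReal.rpow_lt_top_of_nonneg (by positivity) (ENNReal.sum_lt_top.2 fun t _ => ?_).ne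
  exact ENNReal.rpow_lt_top_of_nonneg hq.le enorm_ne_top

end Coefficients

/-! ### Mixed norms on rectangles -/

section MixedNorm

variable {G₁ G₂ : Type*} [MeasurableSpace G₁] [MeasurableSpace G₂] {μ₁ : Measure G₁}
  {μ₂ : Measure G₂} {p q : ℝ} {A : Set G₁} {B : Set G₂} {f g : G₁ × G₂ → ℂ}

lemma mixedNorm_congr (hA : MeasurableSet A) (hB : MeasurableSet B)
    (h : ∀ z ∈ A ×ˢ B, f z = g z) : mixedNorm μ₁ μ₂ p q A B f = mixedNorm μ₁ μ₂ p q A B g := by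
  unfold mixedNorm
  congr 1
  refine setLIntegral_congr_fun hA fun u hu => ?_
  congr 1
  exact setLIntegral_congr_fun hB fun v hv => by rw [h (u, v) ⟨hu, hv⟩]

lemma mixedNorm_le_univ (hp : 0 < p) (hq : 0 < q) :
    mixedNorm μ₁ μ₂ p q A B f ≤ mixedNorm μ₁ μ₂ p q univ univ f := by
  unfold mixedNorm
  simp only [Measure.restrict_univ]
  refine ENNReal.rpow_le_rpow ((setLIntegral_le_lintegral _ _).trans
    (lintegral_mono fun u => ?_)) (by positivity)
  exact ENNReal.rpow_le_rpow (setLIntegral_le_lintegral _ _) (by positivity)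

lemma mixedNorm_one_one (hA : μ₁ A ≠ ∞) (hB : μ₂ B ≠ ∞) (hf : Measurable f) :
    mixedNorm μ₁ μ₂ 1 1 A B f = ∫⁻ z, ‖f z‖ₑ ∂rectMeasure μ₁ μ₂ A B := by
  have : IsFiniteMeasure (μ₁.restrict A) := isFiniteMeasure_restrict.2 hA
  have : IsFiniteMeasure (μ₂.restrict B) := isFiniteMeasure_restrict.2 hB
  rw [rectMeasure, lintegral_prod _ hf.enorm.aemeasurable]
  simp [mixedNorm]

lemma ae_mem_rectMeasure (hA : MeasurableSet A) (hB : MeasurableSet B) (hA' : μ₁ A ≠ ∞)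
    (hB' : μ₂ B ≠ ∞) : ∀ᵐ z ∂rectMeasure μ₁ μ₂ A B, z ∈ A ×ˢ B := by
  have : IsFiniteMeasure (μ₁.restrict A) := isFiniteMeasure_restrict.2 hA'
  have : IsFiniteMeasure (μ₂.restrict B) := isFiniteMeasure_restrict.2 hB'
  have h₁ : ∀ᵐ z ∂(μ₁.restrict A).prod (μ₂.restrict B), z.1 ∈ A :=
    Measure.quasiMeasurePreserving_fst.ae (ae_restrict_mem hA)
  have h₂ : ∀ᵐ z ∂(μ₁.restrict A).prod (μ₂.restrict B), z.2 ∈ B :=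
    Measure.quasiMeasurePreserving_snd.ae (ae_restrict_mem hB)
  exact h₁.and h₂

lemma memMixed_of_hasCompactSupport [TopologicalSpace G₁] [T2Space G₁] [BorelSpace G₁]
    [TopologicalSpace G₂] [T2Space G₂] [BorelSpace G₂] [IsFiniteMeasureOnCompacts μ₁]
    [IsFiniteMeasureOnCompacts μ₂] (hp : 0 < p) (hq : 0 < q) (hf : Continuous f)
    (hfc : HasCompactSupport f) : MemMixed μ₁ μ₂ p q f := by
  refine ⟨hfc.measurable_of_prod hf, ?_⟩
  obtain ⟨C, hC⟩ := hf.bounded_above_of_compact_support hfc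
  have hA := hfc.isCompact.image continuous_fst
  have hB := hfc.isCompact.image continuous_snd
  set A := Prod.fst '' tsupport f
  set B := Prod.snd '' tsupport f
  have hA0 : ∀ u v, u ∉ A → f (u, v) = 0 := fun u v hu =>
    image_eq_zero_of_notMem_tsupport fun h => hu ⟨_, h, rfl⟩
  have hB0 : ∀ u v, v ∉ B → f (u, v) = 0 := fun u v hv =>
    image_eq_zero_of_notMem_tsupport fun h => hv ⟨_, h, rfl⟩
  have hin : ∀ u, ∫⁻ v, ‖f (u, v)‖ₑ ^ q ∂μ₂ ≤ ENNReal.ofReal C ^ q * μ₂ B := by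
    intro u
    rw [← lintegral_indicator_const hB.measurableSet]
    refine lintegral_mono fun v => ?_
    by_cases hv : v ∈ B
    · rw [indicator_of_mem hv]
      refine ENNReal.rpow_le_rpow ?_ hq.le
      rw [← ofReal_norm]
      exact ENNReal.ofReal_le_ofReal (hC _)
    · simp [hB0 u v hv, hq]
  have hout : ∫⁻ u, (∫⁻ v, ‖f (u, v)‖ₑ ^ q ∂μ₂) ^ (p / q) ∂μ₁ ≤
      (ENNReal.ofReal C ^ q * μ₂ B) ^ (p / q) * μ₁ A := by
    rw [← lintegral_indicator_const hA.measurableSet]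
    refine lintegral_mono fun u => ?_
    by_cases hu : u ∈ A
    · rw [indicator_of_mem hu]
      exact ENNReal.rpow_le_rpow (hin u) (by positivity)
    · have : 0 < p / q := by positivity
      simp [hA0 u _ hu, hq, this]
  unfold mixedNorm
  simp only [Measure.restrict_univ]
  refine ENNReal.rpow_lt_top_of_nonneg (by positivity) (hout.trans_lt ?_).ne
  refine ENNReal.mul_lt_top (ENNReal.rpow_lt_top_of_nonneg (by positivity) ?_) hA.measure_lt_top
  exact ENNReal.mul_ne_top (ENNReal.rpow_ne_top_of_nonneg hq.le ENNReal.ofReal_ne_top)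
    hB.measure_lt_top.ne

end MixedNorm

/-! ### Convolution with a function of compact support -/

section Convolution

variable {G₁ G₂ : Type*} [AddCommGroup G₁] [AddCommGroup G₂] [MeasurableSpace G₁]
  [MeasurableSpace G₂] {μ₁ : Measure G₁} {μ₂ : Measure G₂} {W₁ : Set G₁} {W₂ : Set G₂}
  {f g ω : G₁ × G₂ → ℂ}

/-- The convolution at a point of `K` only involves the values of `f` on `K - W`. -/
lemma conv_congr {K₁ : Set G₁} {K₂ : Set G₂} (hω : ∀ w ∉ W₁ ×ˢ W₂, ω w = 0)
    (h : ∀ z ∈ (K₁ - W₁) ×ˢ (K₂ - W₂), f z = g z) {z : G₁ × G₂} (hz : z ∈ K₁ ×ˢ K₂) :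
    conv μ₁ μ₂ f ω z = conv μ₁ μ₂ g ω z := by
  unfold conv
  congr 1 with u
  congr 1 with v
  by_cases hw : (u, v) ∈ W₁ ×ˢ W₂
  · rw [h (z.1 - u, z.2 - v) ⟨sub_mem_sub hz.1 hw.1, sub_mem_sub hz.2 hw.2⟩]
  · rw [hω _ hw, mul_zero, mul_zero]

omit [AddCommGroup G₁] [AddCommGroup G₂] in
lemma integrable_rectMeasure (hW₁ : μ₁ W₁ ≠ ∞) (hW₂ : μ₂ W₂ ≠ ∞) (hω : MemMixed μ₁ μ₂ 1 1 ω) :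
    Integrable ω (rectMeasure μ₁ μ₂ W₁ W₂) := by
  refine ⟨hω.1.aestronglyMeasurable, ?_⟩
  rw [HasFiniteIntegral, ← mixedNorm_one_one hW₁ hW₂ hω.1]
  exact (mixedNorm_le_univ one_pos one_pos).trans_lt hω.2

variable [TopologicalSpace G₁] [IsTopologicalAddGroup G₁] [BorelSpace G₁] [TopologicalSpace G₂]
  [IsTopologicalAddGroup G₂] [BorelSpace G₂]

/-- Only the reflection in each factor is used, so no measurability of subtraction on `G × G`
(which may fail without second countability) is needed. -/
lemma integrable_conv_integrand (hW₁ : μ₁ W₁ ≠ ∞) (hW₂ : μ₂ W₂ ≠ ∞)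
    (hω : MemMixed μ₁ μ₂ 1 1 ω) (hf : Continuous f) (hfc : HasCompactSupport f) (z : G₁ × G₂) :
    Integrable (fun w : G₁ × G₂ => f (z.1 - w.1, z.2 - w.2) * ω w)
      (rectMeasure μ₁ μ₂ W₁ W₂) := by
  obtain ⟨C, hC⟩ := hf.bounded_above_of_compact_support hfc
  have hm : Measurable fun w : G₁ × G₂ => (z.1 - w.1, z.2 - w.2) :=
    ((continuous_const.sub continuous_id).measurable.comp measurable_fst).prodMk
      ((continuous_const.sub continuous_id).measurable.comp measurable_snd)
  exact (integrable_rectMeasure hW₁ hW₂ hω).bdd_mul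
    ((hfc.measurable_of_prod hf).comp hm).aestronglyMeasurable (.of_forall fun w => hC _)

/-- The iterated integral is an integral over the finite measure `rectMeasure` of the compact
support; Fubini's theorem does not apply to the Haar measures, which need not be `σ`-finite. -/
lemma conv_eq_integral (hW₁ : μ₁ W₁ ≠ ∞) (hW₂ : μ₂ W₂ ≠ ∞) (hω : MemMixed μ₁ μ₂ 1 1 ω)
    (hω0 : ∀ w ∉ W₁ ×ˢ W₂, ω w = 0) (hf : Continuous f) (hfc : HasCompactSupport f)
    (z : G₁ × G₂) : conv μ₁ μ₂ f ω z =
      ∫ w, f (z.1 - w.1, z.2 - w.2) * ω w ∂rectMeasure μ₁ μ₂ W₁ W₂ := by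
  have : IsFiniteMeasure (μ₁.restrict W₁) := isFiniteMeasure_restrict.2 hW₁
  have : IsFiniteMeasure (μ₂.restrict W₂) := isFiniteMeasure_restrict.2 hW₂
  have hint := integrable_conv_integrand hW₁ hW₂ hω hf hfc z
  rw [rectMeasure] at hint ⊢
  rw [integral_prod _ hint, conv, setIntegral_eq_integral_of_forall_compl_eq_zero]
  · congr 1 with u
    rw [setIntegral_eq_integral_of_forall_compl_eq_zero]
    intro v hv
    rw [hω0 (u, v) fun h => hv h.2, mul_zero]
  · intro u hu
    simp [hω0 (u, _) fun h => hu h.1]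

/-- Convolution is linear on continuous functions with compact support. -/
lemma conv_sum_smul (hW₁ : μ₁ W₁ ≠ ∞) (hW₂ : μ₂ W₂ ≠ ∞) (hω : MemMixed μ₁ μ₂ 1 1 ω)
    (hω0 : ∀ w ∉ W₁ ×ˢ W₂, ω w = 0) {n : ℕ} {b : Fin n → G₁ × G₂ → ℂ}
    (hb : ∀ i, Continuous (b i)) (hbc : ∀ i, HasCompactSupport (b i)) {a : Fin n → ℂ}
    (hf : Continuous f) (hfc : HasCompactSupport f) (hfb : f = ∑ i, a i • b i) (z : G₁ × G₂) :
    conv μ₁ μ₂ f ω z = ∑ i, a i * conv μ₁ μ₂ (b i) ω z := by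
  simp only [conv_eq_integral hW₁ hW₂ hω hω0 hf hfc,
    conv_eq_integral hW₁ hW₂ hω hω0 (hb _) (hbc _), ← integral_const_mul]
  rw [← integral_finsetSum _ fun i _ =>
    (integrable_conv_integrand hW₁ hW₂ hω (hb i) (hbc i) z).const_mul (a i)]
  congr 1 with w
  simp [hfb, Finset.sum_mul, mul_assoc]

lemma enorm_conv_le [T2Space G₁] [T2Space G₂] [IsFiniteMeasureOnCompacts μ₁]
    [IsFiniteMeasureOnCompacts μ₂] (hW₁ : IsCompact W₁) (hW₂ : IsCompact W₂)
    (hω : MemMixed μ₁ μ₂ 1 1 ω) (hω0 : ∀ w ∉ W₁ ×ˢ W₂, ω w = 0) (hf : Continuous f)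
    (hfc : HasCompactSupport f) {z : G₁ × G₂} {C : ℝ≥0∞}
    (hC : ∀ w ∈ W₁ ×ˢ W₂, ‖f (z.1 - w.1, z.2 - w.2)‖ₑ ≤ C) :
    ‖conv μ₁ μ₂ f ω z‖ₑ ≤ C * mixedNorm μ₁ μ₂ 1 1 W₁ W₂ ω := by
  have h₁ := (hW₁.measure_lt_top (μ := μ₁)).ne
  have h₂ := (hW₂.measure_lt_top (μ := μ₂)).ne
  rw [conv_eq_integral h₁ h₂ hω hω0 hf hfc,
    mixedNorm_one_one h₁ h₂ hω.1, ← lintegral_const_mul _ hω.1.enorm]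
  refine (enorm_integral_le_lintegral_enorm _).trans (lintegral_mono_ae ?_)
  filter_upwards [ae_mem_rectMeasure hW₁.measurableSet hW₂.measurableSet h₁ h₂] with w hw
  rw [enorm_mul]
  gcongr
  exact hC w hw

/-- The translates of `f` depend continuously on the translation, uniformly on the compact set
where `ω` lives. (Dominated convergence would require first countability.) -/
lemma continuous_conv [T2Space G₁] [T2Space G₂] [IsFiniteMeasureOnCompacts μ₁]
    [IsFiniteMeasureOnCompacts μ₂] (hW₁ : IsCompact W₁) (hW₂ : IsCompact W₂)
    (hω : MemMixed μ₁ μ₂ 1 1 ω) (hω0 : ∀ w ∉ W₁ ×ˢ W₂, ω w = 0) (hf : Continuous f)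
    (hfc : HasCompactSupport f) : Continuous (conv μ₁ μ₂ f ω) := by
  have h₁ := (hW₁.measure_lt_top (μ := μ₁)).ne
  have h₂ := (hW₂.measure_lt_top (μ := μ₂)).ne
  have hωi := integrable_rectMeasure h₁ h₂ hω
  have hi := integrable_conv_integrand h₁ h₂ hω hf hfc
  set J := ∫ w, ‖ω w‖ ∂rectMeasure μ₁ μ₂ W₁ W₂ with hJ
  have hJ0 : 0 ≤ J := integral_nonneg fun _ => norm_nonneg _
  rw [continuous_iff_continuousAt]
  intro z
  rw [ContinuousAt, Metric.tendsto_nhds]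
  intro ε hε
  have hδ : 0 < ε / (J + 1) := by positivity
  have hcont : Continuous (Function.uncurry fun (z w : G₁ × G₂) =>
      f (z.1 - w.1, z.2 - w.2)) := by
    refine hf.comp ?_
    fun_prop
  obtain ⟨v, hv, hvW⟩ := (hW₁.prod hW₂).mem_uniformity_of_prod (s := univ) (q := z)
    hcont.continuousOn (mem_univ z) (Metric.dist_mem_uniformity hδ)
  rw [nhdsWithin_univ] at hv
  filter_upwards [hv] with z' hz'
  rw [conv_eq_integral h₁ h₂ hω hω0 hf hfc, conv_eq_integral h₁ h₂ hω hω0 hf hfc,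
    dist_eq_norm, ← integral_sub (hi z') (hi z)]
  calc ‖∫ w, f (z'.1 - w.1, z'.2 - w.2) * ω w - f (z.1 - w.1, z.2 - w.2) * ω w
        ∂rectMeasure μ₁ μ₂ W₁ W₂‖
      ≤ ∫ w, ε / (J + 1) * ‖ω w‖ ∂rectMeasure μ₁ μ₂ W₁ W₂ := by
        refine norm_integral_le_of_norm_le (hωi.norm.const_mul _) ?_
        filter_upwards [ae_mem_rectMeasure hW₁.measurableSet hW₂.measurableSet h₁ h₂] with w hw
        rw [← sub_mul, norm_mul]
        gcongr
        have h : dist (f (z'.1 - w.1, z'.2 - w.2)) (f (z.1 - w.1, z.2 - w.2)) < ε / (J + 1) :=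
          hvW z' hz' w hw
        rw [dist_eq_norm] at h
        exact h.le
    _ = ε * (J / (J + 1)) := by
        rw [integral_const_mul, ← hJ]
        ring
    _ < ε := by
        have : J / (J + 1) < 1 := (div_lt_one (by positivity)).2 (by linarith)
        nlinarith

lemma measurable_conv [T2Space G₁] [T2Space G₂] [IsFiniteMeasureOnCompacts μ₁]
    [IsFiniteMeasureOnCompacts μ₂] (hW₁ : IsCompact W₁) (hW₂ : IsCompact W₂)
    (hω : MemMixed μ₁ μ₂ 1 1 ω) (hω0 : ∀ w ∉ W₁ ×ˢ W₂, ω w = 0) (hf : Continuous f)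
    (hfc : HasCompactSupport f) : Measurable (conv μ₁ μ₂ f ω) := by
  refine HasCompactSupport.measurable_of_prod (continuous_conv hW₁ hW₂ hω hω0 hf hfc) ?_
  refine HasCompactSupport.intro (hfc.isCompact.add (hW₁.prod hW₂)) fun z hz => ?_
  unfold conv
  have : ∀ u v, f (z.1 - u, z.2 - v) * ω (u, v) = 0 := by
    intro u v
    by_contra h
    refine hz ⟨_, subset_tsupport _ (left_ne_zero_of_mul h), (u, v), ?_, by ext <;> simp⟩
    by_contra hw
    exact right_ne_zero_of_mul h (hω0 _ hw)
  simp [this]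

end Convolution

/-! ### The local space as a space of finite sums -/

section LocalSpace

variable {G₁ G₂ : Type*} [AddCommGroup G₁] [TopologicalSpace G₁] [IsTopologicalAddGroup G₁]
  [T2Space G₁] [MeasurableSpace G₁] [BorelSpace G₁] [AddCommGroup G₂] [TopologicalSpace G₂]
  [IsTopologicalAddGroup G₂] [T2Space G₂] [MeasurableSpace G₂] [BorelSpace G₂]
  {μ₁ : Measure G₁} {μ₂ : Measure G₂} [IsFiniteMeasureOnCompacts μ₁]
  [IsFiniteMeasureOnCompacts μ₂] {p q : ℝ} {ι : Type*} {x : ι → G₁} {y : ι → G₂} {r : ℕ}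
  {φ : Fin r → G₁ × G₂ → ℂ} {A : Set G₁} {B : Set G₂} {T : Finset (ι × ι)}

lemma shiftMap_mem_localSpace (hp : 0 < p) (hq : 0 < q) (hφ : ∀ i, Continuous (φ i))
    (hφc : ∀ i, HasCompactSupport (φ i)) (hT : relevantShifts A B φ x y ⊆ T)
    (c : Fin r → ι → ι → ℂ) :
    shiftMap φ x y T c ∈ localSpace μ₁ μ₂ p q A B φ x y := by
  refine ⟨memMixed_of_hasCompactSupport hp hq (continuous_shiftMap hφ x y T c)
    (hasCompactSupport_shiftMap hφc x y T c), truncate T c, fun i => ?_, fun z hz => ?_⟩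
  · exact seqNorm_lt_top hp hq T fun s t h => truncate_of_notMem c i h
  · rw [shiftSum_eq_shiftMap hT _ hz, shiftMap_truncate]

/-- The restrictions to `A × B` of the sums of shifts over `T`. -/
def restrictedShifts (A : Set G₁) (B : Set G₂) (φ : Fin r → G₁ × G₂ → ℂ) (x : ι → G₁)
    (y : ι → G₂) (T : Finset (ι × ι)) : Submodule ℂ (↥(A ×ˢ B) → ℂ) :=
  LinearMap.range (LinearMap.funLeft ℂ ℂ (Subtype.val : ↥(A ×ˢ B) → G₁ × G₂) ∘ₗ
    shiftMap φ x y T)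

/-- As `T` contains all shifts that matter on `A × B`, the local space, regarded as a set of
functions on `A × B`, is the complex vector space of the finite sums of shifts. -/
lemma restrict_image_localSpace (hp : 0 < p) (hq : 0 < q) (hφ : ∀ i, Continuous (φ i))
    (hφc : ∀ i, HasCompactSupport (φ i)) (hT : relevantShifts A B φ x y ⊆ T) :
    (fun (f : G₁ × G₂ → ℂ) (z : ↥(A ×ˢ B)) => f z) '' localSpace μ₁ μ₂ p q A B φ x y =
      restrictedShifts A B φ x y T := by
  ext g
  constructor
  · rintro ⟨f, ⟨-, c, -, hc⟩, rfl⟩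
    refine ⟨c, ?_⟩
    ext z
    change shiftMap φ x y T c z = f z
    rw [hc z z.2, shiftSum_eq_shiftMap hT c z.2]
  · rintro ⟨c, rfl⟩
    exact ⟨_, shiftMap_mem_localSpace hp hq hφ hφc hT c, rfl⟩

lemma realDim_eq (hp : 0 < p) (hq : 0 < q) (hφ : ∀ i, Continuous (φ i))
    (hφc : ∀ i, HasCompactSupport (φ i)) (hT : relevantShifts A B φ x y ⊆ T) :
    realDim μ₁ μ₂ p q A B φ x y =
      2 * Module.finrank ℂ (restrictedShifts A B φ x y T) := by
  rw [realDim, restrict_image_localSpace hp hq hφ hφc hT,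
    show ((restrictedShifts A B φ x y T : Submodule ℂ _) : Set (↥(A ×ˢ B) → ℂ)) =
      ((restrictedShifts A B φ x y T).restrictScalars ℝ : Set _) from rfl, Submodule.span_eq]
  exact finrank_real_of_complex (restrictedShifts A B φ x y T)

end LocalSpace

/-! ### The supremum bound from stability -/

section Stability

variable {G₁ G₂ : Type*} [AddCommGroup G₁] [TopologicalSpace G₁] [MeasurableSpace G₁]
  [AddCommGroup G₂] [TopologicalSpace G₂] [MeasurableSpace G₂] {μ₁ : Measure G₁}
  {μ₂ : Measure G₂} {p q : ℝ} {ι : Type*} {x : ι → G₁} {y : ι → G₂} {r : ℕ}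
  {φ : Fin r → G₁ × G₂ → ℂ} {A : Set G₁} {B : Set G₂} {T : Finset (ι × ι)}

/-- The stability of the shifts bounds the coefficients by the norm; hence the values. -/
lemma StableShifts.enorm_le (hp : 0 < p) (hq : 0 < q) {a₁ a₂ : ℝ}
    (hstable : StableShifts μ₁ μ₂ p q A B φ x y a₁ a₂) (hA : MeasurableSet A)
    (hB : MeasurableSet B) (hφ : ∀ i, Continuous (φ i)) (hφc : ∀ i, HasCompactSupport (φ i))
    (hT : relevantShifts A B φ x y = T) (c : Fin r → ι → ι → ℂ) {z : G₁ × G₂}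
    (hz : z ∈ A ×ˢ B) :
    ENNReal.ofReal a₁ * ‖shiftMap φ x y T c z‖ₑ ≤
      ENNReal.ofReal (supShift A B φ x y) * mixedNorm μ₁ μ₂ p q A B (shiftMap φ x y T c) := by
  have hn : ∀ i, seqNorm p q (truncate T c i) < ∞ := fun i =>
    seqNorm_lt_top hp hq T fun s t h => truncate_of_notMem c i h
  have hlow := (hstable (truncate T c) hn fun s t hst i => by
    refine truncate_of_notMem c i fun h => ?_
    rw [← Finset.mem_coe, ← hT] at h
    obtain ⟨z, hz, i, hi⟩ := h
    exact hi (hst z hz i)).1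
  have hcongr : mixedNorm μ₁ μ₂ p q A B (shiftSum φ x y (truncate T c)) =
      mixedNorm μ₁ μ₂ p q A B (shiftMap φ x y T c) :=
    mixedNorm_congr hA hB fun z hz => by
      rw [shiftSum_eq_shiftMap hT.le _ hz, shiftMap_truncate]
  rw [hcongr] at hlow
  set S := ∑ i, seqNorm p q (truncate T c i)
  have hval : ‖shiftMap φ x y T c z‖ₑ ≤ S * ENNReal.ofReal (supShift A B φ x y) := by
    calc ‖shiftMap φ x y T c z‖ₑ
        ≤ ∑ st ∈ T, ∑ i, ‖truncate T c i st.1 st.2 * φ i (z.1 - x st.1, z.2 - y st.2)‖ₑ := by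
          rw [← shiftMap_truncate, shiftMap_apply]
          exact (enorm_sum_le _ _).trans (Finset.sum_le_sum fun st _ => enorm_sum_le _ _)
      _ ≤ ∑ st ∈ T, ∑ i, S * ENNReal.ofReal ‖φ i (z.1 - x st.1, z.2 - y st.2)‖ := by
          refine Finset.sum_le_sum fun st _ => Finset.sum_le_sum fun i _ => ?_
          rw [enorm_mul, ofReal_norm]
          gcongr
          exact (enorm_le_seqNorm hp hq _ _ _).trans
            (Finset.single_le_sum (f := fun i => seqNorm p q (truncate T c i))
              (fun _ _ => zero_le) (Finset.mem_univ i))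
      _ = S * ENNReal.ofReal (∑ st ∈ T, ∑ i, ‖φ i (z.1 - x st.1, z.2 - y st.2)‖) := by
          rw [ENNReal.ofReal_sum_of_nonneg fun st _ => Finset.sum_nonneg fun i _ => norm_nonneg _,
            Finset.mul_sum]
          refine Finset.sum_congr rfl fun st _ => ?_
          rw [ENNReal.ofReal_sum_of_nonneg fun i _ => norm_nonneg _, Finset.mul_sum]
      _ ≤ S * ENNReal.ofReal (supShift A B φ x y) := by
          gcongr
          exact sum_norm_shift_le_supShift hφ hφc hT.le hz
  calc ENNReal.ofReal a₁ * ‖shiftMap φ x y T c z‖ₑ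
      ≤ ENNReal.ofReal a₁ * (S * ENNReal.ofReal (supShift A B φ x y)) := by gcongr
    _ = ENNReal.ofReal (supShift A B φ x y) * (ENNReal.ofReal a₁ * S) := by ring
    _ ≤ _ := by gcongr

end Stability

/-! ### The probability of a nonzero sample -/

section SampleProbability

variable {G₁ G₂ : Type*} [MeasurableSpace G₁] [MeasurableSpace G₂] {μ₁ : Measure G₁}
  {μ₂ : Measure G₂} {K₁ : Set G₁} {K₂ : Set G₂}

/-- A function on `K` that is bounded by `M L` and has `L¹` norm at least `m L` is nonzero at a
random point whose density is at least `Cρ` with probability at least `Cρ m / M`: compare the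
expectation of its absolute value with the supremum. -/
lemma le_mul_measure_ne_zero (hK₁ : MeasurableSet K₁) (hK₂ : MeasurableSet K₂) (h₁ : μ₁ K₁ ≠ ∞)
    (h₂ : μ₂ K₂ ≠ ∞) {ρ : G₁ × G₂ → ℝ} {Cρ : ℝ} (hρ : ∀ z ∈ K₁ ×ˢ K₂, Cρ ≤ ρ z)
    {g : G₁ × G₂ → ℂ} (hg : Measurable g) {m M L : ℝ≥0∞} (hL : L ≠ 0) (hL' : L ≠ ∞)
    (hlow : m * L ≤ mixedNorm μ₁ μ₂ 1 1 K₁ K₂ g) (hup : ∀ z ∈ K₁ ×ˢ K₂, ‖g z‖ₑ ≤ M * L) :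
    ENNReal.ofReal Cρ * m ≤ M * ((rectMeasure μ₁ μ₂ K₁ K₂).withDensity
      fun z => ENNReal.ofReal (ρ z)) {z | g z ≠ 0} := by
  set σ := rectMeasure μ₁ μ₂ K₁ K₂
  set law := σ.withDensity fun z => ENNReal.ofReal (ρ z) with hlaw
  have hae := ae_mem_rectMeasure hK₁ hK₂ h₁ h₂
  have hlaw_ae : ∀ᵐ z ∂law, z ∈ K₁ ×ˢ K₂ := withDensity_absolutelyContinuous _ _ hae
  have hmeas : MeasurableSet {z | g z ≠ 0} := hg (measurableSet_singleton 0).compl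
  have hle : ENNReal.ofReal Cρ • σ ≤ law := by
    rw [← withDensity_const]
    refine withDensity_mono ?_
    filter_upwards [hae] with z hz
    exact ENNReal.ofReal_le_ofReal (hρ z hz)
  have key : ENNReal.ofReal Cρ * m * L ≤ M * law {z | g z ≠ 0} * L := by
    calc ENNReal.ofReal Cρ * m * L ≤ ENNReal.ofReal Cρ * ∫⁻ z, ‖g z‖ₑ ∂σ := by
          rw [mul_assoc, ← mixedNorm_one_one h₁ h₂ hg]
          gcongr
      _ = ∫⁻ z, ‖g z‖ₑ ∂(ENNReal.ofReal Cρ • σ) := by rw [lintegral_smul_measure, smul_eq_mul]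
      _ ≤ ∫⁻ z, ‖g z‖ₑ ∂law := lintegral_mono' hle le_rfl
      _ ≤ ∫⁻ z, {z | g z ≠ 0}.indicator (fun _ => M * L) z ∂law := by
          refine lintegral_mono_ae ?_
          filter_upwards [hlaw_ae] with z hz
          by_cases h : g z = 0
          · simp [h]
          · rw [indicator_of_mem (show z ∈ {z | g z ≠ 0} from h)]
            exact hup z hz
      _ = M * law {z | g z ≠ 0} * L := by
          rw [lintegral_indicator_const hmeas]
          ring
  exact (ENNReal.mul_le_mul_iff_left hL hL').1 key

end SampleProbability

section LowerBound

variable {G₁ G₂ : Type*} [AddCommGroup G₁] [TopologicalSpace G₁] [IsTopologicalAddGroup G₁]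
  [T2Space G₁] [MeasurableSpace G₁] [BorelSpace G₁] [AddCommGroup G₂] [TopologicalSpace G₂]
  [IsTopologicalAddGroup G₂] [T2Space G₂] [MeasurableSpace G₂] [BorelSpace G₂]
  {μ₁ : Measure G₁} {μ₂ : Measure G₂} [IsFiniteMeasureOnCompacts μ₁]
  [IsFiniteMeasureOnCompacts μ₂] {p q : ℝ} {ι : Type*} {x : ι → G₁} {y : ι → G₂} {r : ℕ}
  {φ : Fin r → G₁ × G₂ → ℂ} {T : Finset (ι × ι)} {W₁ K₁ : Set G₁} {W₂ K₂ : Set G₂}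
  {ω : G₁ × G₂ → ℂ}

/-- An average of a nonzero element of the local space at a random point is nonzero with
probability at least `Cρ μt a₁ / C_Φ`. -/
lemma le_mul_measure_conv_ne_zero (hp : 0 < p) (hq : 0 < q) (hW₁ : IsCompact W₁)
    (hW₂ : IsCompact W₂) (hω : MemMixed μ₁ μ₂ 1 1 ω) (hωW : ∀ w ∉ W₁ ×ˢ W₂, ω w = 0)
    (hω0 : mixedNorm μ₁ μ₂ 1 1 W₁ W₂ ω ≠ 0) (hK₁ : IsCompact K₁) (hK₂ : IsCompact K₂)
    (hφ : ∀ i, Continuous (φ i)) (hφc : ∀ i, HasCompactSupport (φ i)) {a₁ a₂ : ℝ} (ha₁ : 0 < a₁)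
    (hstable : StableShifts μ₁ μ₂ p q (K₁ - W₁) (K₂ - W₂) φ x y a₁ a₂)
    (hT : relevantShifts (K₁ - W₁) (K₂ - W₂) φ x y = T) {ρ : G₁ × G₂ → ℝ} {Cρ : ℝ}
    (hρ : ∀ z ∈ K₁ ×ˢ K₂, Cρ ≤ ρ z) {μt : ℝ}
    (hlower : ∀ f ∈ localSpace μ₁ μ₂ p q (K₁ - W₁) (K₂ - W₂) φ x y,
      ENNReal.ofReal μt * mixedNorm μ₁ μ₂ 1 1 W₁ W₂ ω *
          mixedNorm μ₁ μ₂ p q (K₁ - W₁) (K₂ - W₂) f ≤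
        mixedNorm μ₁ μ₂ 1 1 K₁ K₂ (conv μ₁ μ₂ f ω))
    (c : Fin r → ι → ι → ℂ) {z₀ : G₁ × G₂} (hz₀ : z₀ ∈ (K₁ - W₁) ×ˢ (K₂ - W₂))
    (hc : shiftMap φ x y T c z₀ ≠ 0) :
    ENNReal.ofReal Cρ * ENNReal.ofReal μt ≤
      ENNReal.ofReal (supShift (K₁ - W₁) (K₂ - W₂) φ x y) / ENNReal.ofReal a₁ *
        ((rectMeasure μ₁ μ₂ K₁ K₂).withDensity fun z => ENNReal.ofReal (ρ z))
          {z | conv μ₁ μ₂ (shiftMap φ x y T c) ω z ≠ 0} := by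
  have hf := continuous_shiftMap hφ x y T c
  have hfc := hasCompactSupport_shiftMap hφc x y T c
  have hmem := shiftMap_mem_localSpace (μ₁ := μ₁) (μ₂ := μ₂) hp hq hφ hφc hT.le c
  have hval := fun z (hz : z ∈ (K₁ - W₁) ×ˢ (K₂ - W₂)) =>
    hstable.enorm_le hp hq (isCompact_sub hK₁ hW₁).measurableSet
      (isCompact_sub hK₂ hW₂).measurableSet hφ hφc hT c hz
  have hlow := hlower _ hmem
  set F := shiftMap φ x y T c
  set C := supShift (K₁ - W₁) (K₂ - W₂) φ x y
  set N := mixedNorm μ₁ μ₂ p q (K₁ - W₁) (K₂ - W₂) F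
  have ha : ENNReal.ofReal a₁ ≠ 0 := (ENNReal.ofReal_pos.2 ha₁).ne'
  have hN0 : N ≠ 0 := by
    intro h
    have := hval z₀ hz₀
    rw [h, mul_zero, nonpos_iff_eq_zero, mul_eq_zero, enorm_eq_zero] at this
    exact this.elim ha hc
  have hNtop : N ≠ ∞ := ((mixedNorm_le_univ hp hq).trans_lt hmem.1.2).ne
  refine le_mul_measure_ne_zero hK₁.measurableSet hK₂.measurableSet hK₁.measure_lt_top.ne
    hK₂.measure_lt_top.ne hρ (measurable_conv hW₁ hW₂ hω hωW hf hfc)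
    (L := N * mixedNorm μ₁ μ₂ 1 1 W₁ W₂ ω) (mul_ne_zero hN0 hω0)
    (ENNReal.mul_ne_top hNtop ((mixedNorm_le_univ one_pos one_pos).trans_lt hω.2).ne)
    (le_of_eq_of_le (by ring) hlow) fun z hz => ?_
  rw [← mul_assoc]
  refine enorm_conv_le hW₁ hW₂ hω hωW hf hfc fun w hw => ?_
  have := hval (z.1 - w.1, z.2 - w.2) ⟨sub_mem_sub hz.1 hw.1, sub_mem_sub hz.2 hw.2⟩
  rw [← ENNReal.mul_div_right_comm, ENNReal.le_div_iff_mul_le (.inl ha) (.inl ENNReal.ofReal_ne_top),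
    mul_comm]
  exact this

end LowerBound

end RandomAverageSampling

end

/-! ### The sampling theorem -/

theorem theorem4p2
    {G₁ G₂ : Type*}
    [AddCommGroup G₁] [TopologicalSpace G₁] [IsTopologicalAddGroup G₁] [LocallyCompactSpace G₁]
    [T2Space G₁] [MeasurableSpace G₁] [BorelSpace G₁]
    [AddCommGroup G₂] [TopologicalSpace G₂] [IsTopologicalAddGroup G₂] [LocallyCompactSpace G₂]
    [T2Space G₂] [MeasurableSpace G₂] [BorelSpace G₂]
    (μ₁ : MeasureTheory.Measure G₁) [μ₁.IsAddHaarMeasure] [μ₁.Regular]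
    (μ₂ : MeasureTheory.Measure G₂) [μ₂.IsAddHaarMeasure] [μ₂.Regular]
    (p q : ℝ) (hp : 1 < p) (hq : 1 < q)
    -- the separated sequences of shifts
    {ι : Type*} [Countable ι] (x : ι → G₁) (y : ι → G₂)
    (hx : RandomAverageSampling.Separated x) (hy : RandomAverageSampling.Separated y)
    -- the averaging function
    (W₁ : Set G₁) (W₂ : Set G₂) (hW₁ : IsCompact W₁) (hW₂ : IsCompact W₂)
    (h0W₁ : (0 : G₁) ∈ W₁) (h0W₂ : (0 : G₂) ∈ W₂)
    (ω : G₁ × G₂ → ℂ) (hω : RandomAverageSampling.MemMixed μ₁ μ₂ 1 1 ω)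
    (hωW : tsupport ω ⊆ W₁ ×ˢ W₂)
    (hω0 : RandomAverageSampling.mixedNorm μ₁ μ₂ 1 1 W₁ W₂ ω ≠ 0)
    -- the sampling domain and the generators
    (K₁ : Set G₁) (K₂ : Set G₂) (hK₁ : IsCompact K₁) (hK₂ : IsCompact K₂)
    {r : ℕ} (φ : Fin r → G₁ × G₂ → ℂ)
    (hφmem : ∀ i, RandomAverageSampling.MemMixed μ₁ μ₂ p q (φ i))
    (hφcont : ∀ i, Continuous (φ i)) (hφsupp : ∀ i, HasCompactSupport (φ i))
    (a₁ a₂ : ℝ) (ha₁ : 0 < a₁) (ha₂ : a₁ ≤ a₂)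
    (hstable : RandomAverageSampling.StableShifts μ₁ μ₂ p q (K₁ - W₁) (K₂ - W₂) φ x y a₁ a₂)
    (hseq : IsSeqCompact ((K₁ - W₁) ×ˢ (K₂ - W₂) - ⋃ i, tsupport (φ i)))
    -- the density
    (ρ : G₁ × G₂ → ℝ) (Cρ₁ Cρ₂ : ℝ) (hCρ₁ : 0 < Cρ₁)
    (hρ : ∀ z ∈ K₁ ×ˢ K₂, Cρ₁ ≤ ρ z ∧ ρ z ≤ Cρ₂)
    (hρm : AEMeasurable ρ (RandomAverageSampling.rectMeasure μ₁ μ₂ K₁ K₂))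
    -- the i.i.d. random points, indexed by pairs `(j, k)`, with density `ρ` on `K₁ × K₂`
    {S : Type*} [MeasurableSpace S] (P : MeasureTheory.Measure S)
    [MeasureTheory.IsProbabilityMeasure P]
    (Z : ℕ → ℕ → S → G₁ × G₂) (hZm : ∀ j k, Measurable (Z j k))
    (hZind : ProbabilityTheory.iIndepFun (fun jk : ℕ × ℕ => Z jk.1 jk.2) P)
    (hZlaw : ∀ j k, P.map (Z j k) =
      (RandomAverageSampling.rectMeasure μ₁ μ₂ K₁ K₂).withDensity
        (fun z => ENNReal.ofReal (ρ z)))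
    -- the space is nonzero
    (d : ℕ) (hd : d = RandomAverageSampling.realDim μ₁ μ₂ p q (K₁ - W₁) (K₂ - W₂) φ x y)
    (hdpos : 0 < d)
    (CΦ : ℝ) (hCΦ : CΦ = RandomAverageSampling.supShift (K₁ - W₁) (K₂ - W₂) φ x y)
    -- the lower bound for the averages
    (μt : ℝ) (hμt₀ : 0 < μt) (hμt₁ : μt ≤ 1)
    (hlower : ∀ f ∈ RandomAverageSampling.localSpace μ₁ μ₂ p q (K₁ - W₁) (K₂ - W₂) φ x y,
      ENNReal.ofReal μt * RandomAverageSampling.mixedNorm μ₁ μ₂ 1 1 W₁ W₂ ω *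
          RandomAverageSampling.mixedNorm μ₁ μ₂ p q (K₁ - W₁) (K₂ - W₂) f ≤
        RandomAverageSampling.mixedNorm μ₁ μ₂ 1 1 K₁ K₂
          (RandomAverageSampling.conv μ₁ μ₂ f ω))
    (η : ℝ) (hη₀ : 0 < η) (hη₁ : η < μt * Cρ₁)
    (n m : ℕ)
    (hnm : 108 * Real.sqrt 2 * Real.log 2 * (d : ℝ) / η * (2 + 162 / η) < (n : ℝ) * (m : ℝ)) :
    ∃ E : Set S, MeasurableSet E ∧
      1 - 2 * Real.exp ((d : ℝ) * Real.log (8 * CΦ / a₁)) *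
            Real.exp (-((n : ℝ) * (m : ℝ) *
              (3 * a₁ ^ 2 * η ^ 2 / (4 * CΦ * (6 * CΦ + η * a₁)))))
          - 4 / (3 * (d : ℝ) * Real.log 2 ^ 2) * (4 * CΦ / a₁) ^ (2 * d) *
            Real.exp (-((n : ℝ) * (m : ℝ) * (η ^ 2 / (72 * Real.sqrt 2 * (81 + η)))))
        ≤ P.real E ∧
      ∀ e ∈ E, ∃ h : ℕ → ℕ → G₁ × G₂ → ℂ,
        ∀ f ∈ RandomAverageSampling.localSpace μ₁ μ₂ p q (K₁ - W₁) (K₂ - W₂) φ x y,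
          ∀ z ∈ (K₁ - W₁) ×ˢ (K₂ - W₂),
            f z = ∑ j ∈ Finset.Icc 1 n, ∑ k ∈ Finset.Icc 1 m,
              RandomAverageSampling.conv μ₁ μ₂ f ω (Z j k e) * h j k z := by
  open RandomAverageSampling in
  classical
  have hp0 : 0 < p := by linarith
  have hq0 : 0 < q := by linarith
  have hωW0 : ∀ w ∉ W₁ ×ˢ W₂, ω w = 0 := fun w hw =>
    image_eq_zero_of_notMem_tsupport fun h => hw (hωW h)
  have hfin := finite_relevantShifts (isCompact_sub hK₁ hW₁) (isCompact_sub hK₂ hW₂) hφsupp hx hy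
  set T := hfin.toFinset with hTdef
  have hT : relevantShifts (K₁ - W₁) (K₂ - W₂) φ x y = T := by simp [hTdef]
  -- The complex vector space of the restrictions has dimension `D = d / 2`.
  set V := restrictedShifts (K₁ - W₁) (K₂ - W₂) φ x y T
  have hdD : d = 2 * Module.finrank ℂ V := by
    rw [hd, realDim_eq hp0 hq0 hφcont hφsupp hT.le]
  have hDpos : 0 < Module.finrank ℂ V := by omega
  have : Module.Finite ℂ V := Module.finite_of_finrank_pos hDpos
  set D := Module.finrank ℂ V
  let bas := Module.finBasis ℂ V
  choose c hc using fun i => (bas i).2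
  set b : Fin D → G₁ × G₂ → ℂ := fun i => shiftMap φ x y T (c i) with hb
  have hbcont : ∀ i, Continuous (b i) := fun i => continuous_shiftMap hφcont x y T (c i)
  have hbsupp : ∀ i, HasCompactSupport (b i) := fun i =>
    hasCompactSupport_shiftMap hφsupp x y T (c i)
  have hbval : ∀ i (z : ↥((K₁ - W₁) ×ˢ (K₂ - W₂))), (bas i : _ → ℂ) z = b i z := fun i z =>
    (congrFun (hc i) z).symm
  have hcomb : ∀ a : Fin D → ℂ, shiftMap φ x y T (∑ i, a i • c i) = ∑ i, a i • b i := fun a => by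
    simp [hb]
  have hcombV : ∀ (a : Fin D → ℂ) (z : ↥((K₁ - W₁) ×ˢ (K₂ - W₂))),
      ((∑ i, a i • bas i : V) : _ → ℂ) z = shiftMap φ x y T (∑ i, a i • c i) z := fun a z => by
    simp [hcomb, hbval]
  -- Sampling the averages of a combination of the basis is pairing its coefficients with the
  -- vector `Γ` of the averages of the basis.
  set Γ : G₁ × G₂ → Fin D → ℂ := fun z i => conv μ₁ μ₂ (b i) ω z with hΓ
  have hΓm : Measurable Γ := measurable_pi_lambda _ fun i =>
    measurable_conv hW₁ hW₂ hω hωW0 (hbcont i) (hbsupp i)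
  have hconv : ∀ (a : Fin D → ℂ) z,
      conv μ₁ μ₂ (shiftMap φ x y T (∑ i, a i • c i)) ω z = Γ z ⬝ᵥ a := fun a z => by
    rw [conv_sum_smul hW₁.measure_lt_top.ne hW₂.measure_lt_top.ne hω hωW0 hbcont hbsupp
      (continuous_shiftMap hφcont x y T _) (hasCompactSupport_shiftMap hφsupp x y T _) (hcomb a),
      dotProduct_comm]
    rfl
  set law := (rectMeasure μ₁ μ₂ K₁ K₂).withDensity fun z => ENNReal.ofReal (ρ z) with hlaw
  have : IsProbabilityMeasure law := by
    rw [← hZlaw 0 0]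
    exact Measure.isProbabilityMeasure_map (hZm 0 0).aemeasurable
  have hKm : MeasurableSet (K₁ ×ˢ K₂) := hK₁.measurableSet.prod hK₂.measurableSet
  have hΓset : ∀ a : Fin D → ℂ, MeasurableSet {v : Fin D → ℂ | v ⬝ᵥ a = 0} := fun a => by
    refine IsClosed.measurableSet (isClosed_eq ?_ continuous_const)
    simp only [dotProduct]
    fun_prop
  have hprob : ∀ a : Fin D → ℂ, a ≠ 0 → η ≤ CΦ / a₁ * law.real {z | Γ z ⬝ᵥ a ≠ 0} := by
    intro a ha
    have hne : ∃ z ∈ (K₁ - W₁) ×ˢ (K₂ - W₂), shiftMap φ x y T (∑ i, a i • c i) z ≠ 0 := by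
      by_contra! h
      refine ha (funext fun i => Fintype.linearIndependent_iff.1 bas.linearIndependent a ?_ i)
      ext z
      rw [hcombV, h z z.2]
      rfl
    obtain ⟨z₀, hz₀, hne⟩ := hne
    have h := le_mul_measure_conv_ne_zero hp0 hq0 hW₁ hW₂ hω hωW0 hω0 hK₁ hK₂ hφcont hφsupp ha₁
      hstable hT (fun z hz => (hρ z hz).1) hlower _ hz₀ hne
    simp only [hconv, ← hCΦ] at h
    rw [← hlaw, ← ENNReal.ofReal_mul hCρ₁.le, ← ENNReal.ofReal_div_of_pos ha₁,
      ← ofReal_measureReal, ← ENNReal.ofReal_mul' measureReal_nonneg] at h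
    have hpos : 0 < Cρ₁ * μt := mul_pos hCρ₁ hμt₀
    rcases le_total 0 (CΦ / a₁ * law.real {z | Γ z ⬝ᵥ a ≠ 0}) with h0 | h0
    · rw [ENNReal.ofReal_le_ofReal_iff h0] at h
      linarith
    · rw [ENNReal.ofReal_of_nonpos h0, nonpos_iff_eq_zero, ENNReal.ofReal_eq_zero] at h
      linarith
  -- In particular the supremum bound `M = C_Φ / a₁` is at least `η`.
  set M := CΦ / a₁ with hM
  have hMη : 0 < M ∧ η ≤ M := by
    have h := hprob (Pi.single ⟨0, hDpos⟩ 1) (by simp)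
    have h1 : law.real {z | Γ z ⬝ᵥ Pi.single ⟨0, hDpos⟩ 1 ≠ 0} ≤ 1 := measureReal_le_one
    have h0 : 0 ≤ law.real {z | Γ z ⬝ᵥ Pi.single ⟨0, hDpos⟩ 1 ≠ 0} := measureReal_nonneg
    have hM0 : 0 < M := by
      by_contra! hle
      nlinarith
    exact ⟨hM0, by nlinarith⟩
  obtain ⟨hM0, hηM⟩ := hMη
  -- The sample points, enumerated by `Fin (n * m)`.
  set pt : Fin (n * m) → ℕ × ℕ := fun k =>
    ((finProdFinEquiv.symm k).1 + 1, (finProdFinEquiv.symm k).2 + 1) with hpt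
  have hptinj : Function.Injective pt := by
    intro k l hkl
    simp only [hpt, Prod.mk.injEq, add_left_inj, Fin.val_inj] at hkl
    exact finProdFinEquiv.symm.injective (Prod.ext hkl.1 hkl.2)
  set X : Fin (n * m) → S → Fin D → ℂ := fun k e => Γ (Z (pt k).1 (pt k).2 e)
  have hXm : ∀ k, Measurable (X k) := fun k => hΓm.comp (hZm _ _)
  have hXind : iIndepFun X P := (hZind.precomp hptinj).comp (fun _ => Γ) fun _ => hΓm
  set ν := law.map Γ with hν
  have : IsProbabilityMeasure ν := Measure.isProbabilityMeasure_map hΓm.aemeasurable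
  have hXlaw : ∀ k, P.map (X k) = ν := by
    intro k
    rw [hν, ← hZlaw (pt k).1 (pt k).2, Measure.map_map hΓm (hZm _ _)]
    rfl
  have hνa : ∀ a : Fin D → ℂ, a ≠ 0 → ν.real {v | v ⬝ᵥ a = 0} ≤ 1 - η / M := by
    intro a ha
    rw [hν, map_measureReal_apply hΓm (hΓset a)]
    have h := hprob a ha
    have hc : law.real {z | Γ z ⬝ᵥ a ≠ 0} = 1 - law.real (Γ ⁻¹' {v | v ⬝ᵥ a = 0}) :=
      probReal_compl_eq_one_sub (hΓm (hΓset a))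
    rw [hc] at h
    have : η / M ≤ 1 - law.real (Γ ⁻¹' {v | v ⬝ᵥ a = 0}) := (div_le_iff₀' hM0).2 h
    linarith
  set β := max 2 (8 * M)
  have hβ2 : 2 ≤ β := le_max_left _ _
  set U := undetermined (⊤ : Submodule ℂ (Fin D → ℂ)) (n * m)
  have hUm : MeasurableSet U := (isClosed_undetermined _ _).measurableSet
  have hfail : P.real ((fun e k => X k e) ⁻¹' U) ≤
      β ^ D * (1 - η / M + η / M / β) ^ (n * m) :=
    iIndepFun_measure_undetermined_le hXm hXind hXlaw ((div_le_one hM0).2 hηM) (by linarith)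
      (by positivity) hνa
  have hZK : ∀ᵐ e ∂P, ∀ k, Z (pt k).1 (pt k).2 e ∈ K₁ ×ˢ K₂ := by
    rw [ae_all_iff]
    intro k
    refine ae_of_ae_map (hZm _ _).aemeasurable ?_
    rw [hZlaw]
    exact withDensity_absolutelyContinuous _ _ (ae_mem_rectMeasure hK₁.measurableSet
      hK₂.measurableSet hK₁.measure_lt_top.ne hK₂.measure_lt_top.ne)
  refine ⟨{e | ∀ k, Z (pt k).1 (pt k).2 e ∈ K₁ ×ˢ K₂} ∩ ((fun e k => X k e) ⁻¹' U)ᶜ, ?_, ?_, ?_⟩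
  · refine MeasurableSet.inter ?_ (measurable_pi_lambda _ hXm hUm).compl
    simp only [ofPred_forall]
    exact MeasurableSet.iInter fun k => hZm _ _ hKm
  · have hE : P.real ({e | ∀ k, Z (pt k).1 (pt k).2 e ∈ K₁ ×ˢ K₂} ∩
        ((fun e k => X k e) ⁻¹' U)ᶜ) = 1 - P.real ((fun e k => X k e) ⁻¹' U) := by
      rw [← probReal_compl_eq_one_sub (measurable_pi_lambda _ hXm hUm)]
      refine measureReal_congr ?_
      filter_upwards [hZK] with e he
      exact propext ⟨fun h => h.2, fun h => ⟨he, h⟩⟩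
    rw [hE]
    have hq' : 0 ≤ 1 - η / M + η / M / β := by
      have h1 : η / M ≤ 1 := (div_le_one hM0).2 hηM
      have h2 : 0 ≤ η / M / β := by positivity
      linarith
    have h2 : β ^ D * (1 - η / M + η / M / β) ^ (n * m) ≤
        β ^ d * (1 - η / M + η / M / β) ^ (n * m) := by
      gcongr
      · linarith
      · omega
    have h3 := max_pow_mul_pow_le (N := n * m) hM0 hη₀ hηM (by push_cast; exact hnm)
    have h4 : 8 * CΦ / a₁ = 8 * M := by rw [hM]; ring
    have h5 : 3 * a₁ ^ 2 * η ^ 2 / (4 * CΦ * (6 * CΦ + η * a₁)) =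
        3 * η ^ 2 / (4 * M * (6 * M + η)) := by
      have : CΦ = M * a₁ := by rw [hM]; field_simp
      rw [this]
      field_simp
    have h6 : 0 ≤ 4 / (3 * (d : ℝ) * Real.log 2 ^ 2) * (4 * CΦ / a₁) ^ (2 * d) *
        Real.exp (-((n : ℝ) * (m : ℝ) * (η ^ 2 / (72 * Real.sqrt 2 * (81 + η))))) := by
      have : 0 ≤ (4 * CΦ / a₁) ^ (2 * d) := by
        rw [pow_mul]
        positivity
      positivity
    rw [h4, h5]
    push_cast at h3
    linarith
  · rintro e ⟨heK, heU⟩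
    obtain ⟨ψ, hψ⟩ := exists_dual_of_notMem_undetermined heU
    set H : Fin (n * m) → G₁ × G₂ → ℂ := fun l z => ∑ i, ψ l i * b i z with hH
    -- The enumeration is injective, so the sum has at most one term.
    refine ⟨fun j k z => ∑ l with pt l = (j, k), H l z, fun f hf z hz => ?_⟩
    have hfV : (fun z : ↥((K₁ - W₁) ×ˢ (K₂ - W₂)) => f z) ∈ V := by
      have h := mem_image_of_mem (fun (f : G₁ × G₂ → ℂ) (z : ↥((K₁ - W₁) ×ˢ (K₂ - W₂))) => f z) hf
      rw [restrict_image_localSpace hp0 hq0 hφcont hφsupp hT.le] at h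
      exact h
    set a : Fin D → ℂ := fun i => bas.repr ⟨_, hfV⟩ i with ha
    have hfa : ∀ z ∈ (K₁ - W₁) ×ˢ (K₂ - W₂), f z = shiftMap φ x y T (∑ i, a i • c i) z := by
      intro z hz
      rw [← hcombV a ⟨z, hz⟩, ha, bas.sum_repr]
    have hsample : ∀ l, conv μ₁ μ₂ f ω (Z (pt l).1 (pt l).2 e) = X l e ⬝ᵥ a := fun l => by
      rw [conv_congr hωW0 hfa (heK l), hconv]
    have hrec : f z = ∑ l, (X l e ⬝ᵥ a) * H l z := by
      calc f z = ∑ i, a i * b i z := by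
            rw [hfa z hz, hcomb]
            simp
        _ = ∑ i, (∑ l, (X l e ⬝ᵥ a) • ψ l) i * b i z := by rw [← hψ a]
        _ = ∑ l, (X l e ⬝ᵥ a) * H l z := by
            simp only [Finset.sum_apply, Pi.smul_apply, smul_eq_mul, Finset.sum_mul, hH,
              Finset.mul_sum]
            rw [Finset.sum_comm]
            simp only [mul_assoc]
    rw [hrec, ← Finset.sum_product']
    have hmaps : ∀ l ∈ (Finset.univ : Finset (Fin (n * m))),
        pt l ∈ Finset.Icc 1 n ×ˢ Finset.Icc 1 m := by
      intro l _
      simp only [hpt, Finset.mem_product, Finset.mem_Icc]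
      omega
    rw [← Finset.sum_fiberwise_of_maps_to hmaps]
    refine Finset.sum_congr rfl fun jk _ => ?_
    rw [Finset.mul_sum]
    refine Finset.sum_congr rfl fun l hl => ?_
    rw [← hsample l, (Finset.mem_filter.1 hl).2]
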